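/- Let $P$ be a $d$-polytope, $d\ge 3$, in a finite-dimensional Euclidean space, that is, the convex hull of a nonempty finite set of points, of affine dimension $d$. Write $L(P)$ for its face lattice (including $\emptyset$ and $P$), ordered by inclusion. Call a set $D$ a \emph{vertex truncation} $D_1(P)$ of $P$ if there are closed half-spaces $H_v$, one for each vertex $v$ of $P$, such that $H_v$ does not contain $v$ but contains all other vertices of $P$ in its interior, such that $D=P\cap\bigcap_v H_v$, and such that for every edge $e$ of $P$ the set $e\cap D$ consists of one single point, lying in the relative interior of $e$. The polytope $P$ is \emph{truncatable} if such a $D$ exists. For a finite graded poset $L$ with least element, let $E_1(L)$ be the poset of the following subsets of $L$, ordered by reversed inclusion: the empty set, the singletons $\{y\}$ with $y\in L$ of rank $2$, and the intervals $[x,z]\subseteq L$ such that $x<y<z$ for some $y\in L$ of rank $2$. Suppose that $P$ is truncatable. Then every vertex truncation $D$ of $P$ is a $d$-polytope, and for every point $o$ in the relative interior of $D$ the polar of $D$ with respect to $o$ (formed in the affine hull of $D$ with $o$ as origin, i.e. the set of all $y$ in the linear space parallel to that hull such that $\langle y,x-o\rangle\le 1$ for all $x\in D$) is a $d$-polytope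 whose face lattice is isomorphic to $E_1(L(P))$. In particular, the combinatorial type of $D_1(P)$ is uniquely determined by that of $P$: if $Q$ is a $d$-polytope in a possibly different Euclidean space with $L(Q)\cong L(P)$ (for instance $Q=P$), and $D$ and $D'$ are vertex truncations of $P$ and of $Q$, then $L(D)\cong L(D')$. -/

import Mathlib

section Posets

/-- The subsets of a (finite, graded) poset `L` that are elements of `E_t(L)`: the empty set,
the singletons `{y}` with `y` of dimension `t`, and the intervals `[x, z]` such that
`x < y < z` for some `y` of dimension `t`. In a graded poset with least element, the rank of `y`
is its height, and its dimension is its rank minus one. -/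
def IsEtElement {L : Type*} [PartialOrder L] (t : ℕ) (S : Set L) : Prop :=
  S = ∅ ∨
  (∃ y : L, Order.height y = ((t + 1 : ℕ) : ℕ∞) ∧ S = {y}) ∨
  (∃ x z : L, S = Set.Icc x z ∧
    ∃ y : L, Order.height y = ((t + 1 : ℕ) : ℕ∞) ∧ x < y ∧ y < z)

/-- The poset `E_t(L)`; the order is reversed inclusion. -/
abbrev EtPoset (t : ℕ) (L : Type*) [PartialOrder L] : Type _ :=
  {S : Set L // IsEtElement t S}ᵒᵈ

end Posets

section Polytopes

variable {E : Type*} [NormedAddCommGroup E] [InnerProductSpace ℝ E]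

/-- `P` is a `d`-polytope: the convex hull of a nonempty finite set, of affine dimension `d`. -/
def IsDPolytope (d : ℕ) (P : Set E) : Prop :=
  (∃ s : Finset E, s.Nonempty ∧ P = convexHull ℝ (s : Set E)) ∧
    Module.finrank ℝ (vectorSpan ℝ P) = d

/-- The face lattice of `P`, ordered by inclusion: the faces are the empty set, `P` itself and
the intersections of `P` with supporting hyperplanes. -/
abbrev FaceLattice (P : Set E) : Type _ := {G : Set E // IsExposed ℝ P G}

/-- The polytope `P` realizes the poset `L`. -/
def Realizes (P : Set E) (L : Type*) [PartialOrder L] : Prop :=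
  Nonempty (FaceLattice P ≃o L)

/-- `e` is an edge (a one-dimensional face) of `P`. -/
def IsEdgeOf (P e : Set E) : Prop :=
  IsExposed ℝ P e ∧ Module.finrank ℝ (vectorSpan ℝ e) = 1

/-- `H` is a closed half-space. -/
def IsClosedHalfSpace (H : Set E) : Prop :=
  ∃ (l : StrongDual ℝ E) (c : ℝ), l ≠ 0 ∧ H = {x | l x ≤ c}

/-- Intersecting `P` with the half-space `H` truncates the vertex `v` of `P`: `H` is closed, does
not contain `v`, and contains all other vertices of `P` in its interior. -/
def TruncatesVertex (P : Set E) (v : E) (H : Set E) : Prop :=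
  IsClosedHalfSpace H ∧ v ∉ H ∧ ∀ w ∈ P.exposedPoints ℝ, w ≠ v → w ∈ interior H

/-- `D` is one of the polytopes `D_1(P)`: it arises from `P` by truncating all vertices
simultaneously, such that one single relatively interior point remains from each edge of `P`. -/
def IsVertexTruncation (P D : Set E) : Prop :=
  ∃ H : E → Set E,
    (∀ v ∈ P.exposedPoints ℝ, TruncatesVertex P v (H v)) ∧
    D = P ∩ ⋂ v ∈ P.exposedPoints ℝ, H v ∧
    ∀ e : Set E, IsEdgeOf P e → ∃ u ∈ intrinsicInterior ℝ e, e ∩ D = {u}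

/-- The polar of `D` with respect to the point `o`, taken inside the affine hull of `D`, where
`o` is taken as the origin. -/
def polarAt (D : Set E) (o : E) : Set E :=
  {y | y ∈ vectorSpan ℝ D ∧ ∀ x ∈ D, inner ℝ y (x - o) ≤ 1}

end Polytopes

/-! Everything is recorded by edges of P. Each edge meets D in a single point, and every extreme
point of D is such a point (`extremePoints_subset`), so a face of D is determined by the set of
edges it meets (`edgeEmbedding`). An element of E₁(L(P)) is likewise determined by the edges it
contains (`subset_iff_edgesIn_subset`). These are two order embeddings into sets of faces of P, and
L(D) is E₁(L(P)) under inclusion once their ranges agree.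

The empty set corresponds to the empty face and {y} to D ∩ y. An interval [∅, z] gives D ∩ z, and
[{v}, z] gives the part of D ∩ z on the hyperplane cutting off v. Conversely, take a face F of D
meeting at least two edges. If F lies in the cut at v, its supporting functional can be tilted to
support P at v, which gives [{v}, G]. If F lies in no cut, D and P agree locally at some point of F,
so the functional already supports P and gives [∅, G].

The geometric input is that P lies in the cone spanned by its edges at any vertex
(`sub_mem_span_edgeDirections`). It shows that faces are determined by their edges at a vertex, that
each cut is the hull of its edge points, and that D has full dimension (`vectorSpan_eq`). Polarity
reverses inclusion (`polarFaceIso`), matching the order on E₁; uniqueness follows because E₁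
respects isomorphisms. -/

open Set Filter Topology
open scoped NNReal

/-! ### Finite convex hulls, their vertices and exposed faces. -/

section FiniteHulls

variable {E : Type*} [NormedAddCommGroup E] [InnerProductSpace ℝ E]

/-- `X` is the convex hull of a finite set. -/
def IsFiniteHull (X : Set E) : Prop := ∃ s : Set E, s.Finite ∧ X = convexHull ℝ s

theorem IsDPolytope.isFiniteHull {d : ℕ} {X : Set E} (hX : IsDPolytope d X) : IsFiniteHull X := by
  obtain ⟨⟨s, -, hs⟩, -⟩ := hX
  exact ⟨s, s.finite_toSet, hs⟩

theorem IsFiniteHull.isDPolytope {d : ℕ} {X : Set E} (hX : IsFiniteHull X) (hne : X.Nonempty)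
    (hd : Module.finrank ℝ (vectorSpan ℝ X) = d) : IsDPolytope d X := by
  obtain ⟨s, hs, rfl⟩ := hX
  refine ⟨⟨hs.toFinset, ?_, by simp⟩, hd⟩
  rw [convexHull_nonempty_iff] at hne
  simpa using hne

namespace IsFiniteHull

variable {X G : Set E}

theorem convex (hX : IsFiniteHull X) : Convex ℝ X := by
  obtain ⟨s, -, rfl⟩ := hX
  exact convex_convexHull ℝ s

theorem isCompact (hX : IsFiniteHull X) : IsCompact X := by
  obtain ⟨s, hs, rfl⟩ := hX
  exact hs.isCompact_convexHull ℝ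

theorem extremePoints_eq (hX : IsFiniteHull X) : X.extremePoints ℝ = X.exposedPoints ℝ := by
  refine Subset.antisymm ?_ exposedPoints_subset_extremePoints
  obtain ⟨s, hs, rfl⟩ := hX
  intro x hx
  have hxs : x ∈ s := extremePoints_convexHull_subset hx
  have hnot : x ∉ convexHull ℝ (s \ {x}) := by
    intro h
    have := ((convex_convexHull ℝ s).mem_extremePoints_iff_mem_sdiff_convexHull_sdiff.1 hx).2
    exact this (convexHull_mono (sdiff_subset_sdiff_left (subset_convexHull ℝ s)) h)
  obtain ⟨l, u, hlu, hux⟩ := geometric_hahn_banach_closed_point (convex_convexHull ℝ (s \ {x}))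
    ((hs.subset sdiff_subset).isCompact_convexHull ℝ).isClosed hnot
  refine ⟨hx.1, l, fun y hy => ?_⟩
  have hins : s = insert x (s \ {x}) := by
    rw [insert_sdiff_singleton, insert_eq_of_mem hxs]
  by_cases hne : (s \ {x}).Nonempty
  · rw [hins, convexHull_insert hne, mem_convexJoin] at hy
    obtain ⟨a, rfl, b, hb, c, c', hc, hc', hcc, rfl⟩ := hy
    have hlb := hlu b hb
    have heq : l (c • a + c' • b) = l a - c' * (l a - l b) := by
      have : c = 1 - c' := by linarith
      simp only [map_add, map_smul, smul_eq_mul, this]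
      ring
    refine ⟨by rw [heq]; nlinarith, fun h => ?_⟩
    have : c' = 0 := by
      rw [heq] at h
      nlinarith
    subst this
    have : c = 1 := by linarith
    simp [this]
  · rw [not_nonempty_iff_eq_empty] at hne
    rw [hins, hne] at hy
    simp only [insert_empty_eq, convexHull_singleton, mem_singleton_iff] at hy
    subst hy
    simp

theorem finite_exposedPoints (hX : IsFiniteHull X) : (X.exposedPoints ℝ).Finite := by
  rw [← hX.extremePoints_eq]
  obtain ⟨s, hs, rfl⟩ := hX
  exact hs.subset extremePoints_convexHull_subset

theorem _root_.IsCompact.convexHull_extremePoints_eq (hX : IsCompact X) (hc : Convex ℝ X)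
    (hfin : (X.extremePoints ℝ).Finite) : convexHull ℝ (X.extremePoints ℝ) = X := by
  conv_rhs => rw [← closure_convexHull_extremePoints hX hc]
  exact ((hfin.isCompact_convexHull ℝ).isClosed.closure_eq).symm

/-- Extreme points of a face are extreme in X, hence vertices of X and finite in number;
Krein–Milman then needs no closure. -/
theorem convexHull_face (hX : IsFiniteHull X) (hG : IsExposed ℝ X G) :
    convexHull ℝ (X.exposedPoints ℝ ∩ G) = G := by
  have hsub : G.extremePoints ℝ ⊆ X.exposedPoints ℝ ∩ G := by
    rw [← hX.extremePoints_eq]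
    exact fun x hx => ⟨hG.isExtreme.extremePoints_subset_extremePoints hx, hx.1⟩
  refine Subset.antisymm (convexHull_min inter_subset_right (hG.convex hX.convex)) ?_
  conv_lhs => rw [← (hG.isCompact hX.isCompact).convexHull_extremePoints_eq (hG.convex hX.convex)
    (hX.finite_exposedPoints.subset (hsub.trans inter_subset_left))]
  exact convexHull_mono hsub

theorem convexHull_exposedPoints (hX : IsFiniteHull X) : convexHull ℝ (X.exposedPoints ℝ) = X := by
  have := hX.convexHull_face (IsExposed.refl X)
  rwa [inter_eq_left.2 exposedPoints_subset] at this

theorem exists_exposedPoint (hX : IsFiniteHull X) (hG : IsExposed ℝ X G) (hne : G.Nonempty) :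
    ∃ v ∈ X.exposedPoints ℝ, v ∈ G := by
  rw [← hX.convexHull_face hG, convexHull_nonempty_iff] at hne
  exact hne

end IsFiniteHull

theorem le_of_mem_convexHull {s : Set E} {x : E} (l : StrongDual ℝ E) {c : ℝ}
    (hx : x ∈ convexHull ℝ s) (h : ∀ y ∈ s, l y ≤ c) : l x ≤ c :=
  convexHull_min (t := {y | l y ≤ c}) h (convex_halfSpace_le l.toLinearMap.isLinear c) hx

theorem eq_of_mem_convexHull {s : Set E} {x : E} (l : StrongDual ℝ E) {c : ℝ}
    (hx : x ∈ convexHull ℝ s) (h : ∀ y ∈ s, l y = c) : l x = c :=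
  convexHull_min (t := {y | l y = c}) h (convex_hyperplane l.toLinearMap.isLinear c) hx

theorem isExposed_setOf_eq {X : Set E} (l : StrongDual ℝ E) {c : ℝ} (h : ∀ y ∈ X, l y ≤ c) :
    IsExposed ℝ X {x ∈ X | l x = c} := by
  rintro ⟨x, hx, hxc⟩
  refine ⟨l, ?_⟩
  ext z
  refine and_congr_right fun hz => ⟨fun hzc y hy => hzc ▸ h y hy, fun hz' => ?_⟩
  exact le_antisymm (h z hz) (hxc ▸ hz' x hx)

theorem IsExposed.exists_eq_setOf {X G : Set E} (hG : IsExposed ℝ X G) (hne : G.Nonempty) :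
    ∃ (l : StrongDual ℝ E) (c : ℝ), (∀ y ∈ X, l y ≤ c) ∧ G = {x ∈ X | l x = c} := by
  obtain ⟨x, hx⟩ := hne
  obtain ⟨l, hl⟩ := hG ⟨x, hx⟩
  rw [hl] at hx
  refine ⟨l, l x, hx.2, ?_⟩
  rw [hl]
  ext z
  refine and_congr_right fun hz => ⟨fun h => ?_, fun h y hy => h ▸ hx.2 y hy⟩
  exact le_antisymm (hx.2 z hz) (h x hx.1)

end FiniteHulls

/-! ### Cones with nonnegative coefficients. -/

section Cones

variable {E : Type*} [NormedAddCommGroup E] [InnerProductSpace ℝ E]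

theorem convex_setOf_sub_mem (C : Submodule ℝ≥0 E) (v : E) : Convex ℝ {x | x - v ∈ C} := by
  intro x hx y hy a b ha hb hab
  have h : a • x + b • y - v = (⟨a, ha⟩ : ℝ≥0) • (x - v) + (⟨b, hb⟩ : ℝ≥0) • (y - v) := by
    change _ = a • (x - v) + b • (y - v)
    have : b = 1 - a := by linarith
    subst this
    module
  change a • x + b • y - v ∈ C
  rw [h]
  exact C.add_mem (C.smul_mem _ hx) (C.smul_mem _ hy)

theorem smul_mem_of_nonneg (C : Submodule ℝ≥0 E) {a : ℝ} (ha : 0 ≤ a) {x : E} (hx : x ∈ C) :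
    a • x ∈ C :=
  C.smul_mem (⟨a, ha⟩ : ℝ≥0) hx

/-- In a nonnegative combination of nonpositive values, the sum vanishes only if every term does.
The second half therefore describes the face of a cone on which `l` vanishes. -/
theorem map_nonpos_of_mem_span {S : Set E} {y : E} (l : StrongDual ℝ E)
    (hy : y ∈ Submodule.span ℝ≥0 S) (h : ∀ z ∈ S, l z ≤ 0) :
    l y ≤ 0 ∧ (l y = 0 → y ∈ Submodule.span ℝ≥0 {z ∈ S | l z = 0}) := by
  induction hy using Submodule.span_induction with
  | mem x hx => exact ⟨h x hx, fun h0 => Submodule.subset_span ⟨hx, h0⟩⟩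
  | zero => simp
  | add x y _ _ hx hy =>
    rw [map_add]
    refine ⟨add_nonpos hx.1 hy.1, fun h0 => Submodule.add_mem _ (hx.2 ?_) (hy.2 ?_)⟩
    · linarith [hx.1, hy.1]
    · linarith [hx.1, hy.1]
  | smul a x _ hx =>
    have heq : l (a • x) = (a : ℝ) * l x := l.map_smul (a : ℝ) x
    rw [heq]
    refine ⟨mul_nonpos_of_nonneg_of_nonpos a.2 hx.1, fun h0 => ?_⟩
    rcases mul_eq_zero.1 h0 with h0 | h0
    · have : a = 0 := by exact_mod_cast h0
      simp [this]
    · exact Submodule.smul_mem _ _ (hx.2 h0)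

theorem exists_smul_mem_convexHull {S : Set E} {y : E} (hy : y ∈ Submodule.span ℝ≥0 S) :
    y = 0 ∨ ∃ t : ℝ, 0 < t ∧ ∃ k ∈ convexHull ℝ S, y = t • k := by
  induction hy using Submodule.span_induction with
  | mem x hx => exact Or.inr ⟨1, one_pos, x, subset_convexHull ℝ S hx, by simp⟩
  | zero => simp
  | add x y _ _ hx hy =>
    rcases hx with rfl | ⟨t, ht, k, hk, rfl⟩
    · simpa using hy
    rcases hy with rfl | ⟨t', ht', k', hk', rfl⟩
    · exact Or.inr ⟨t, ht, k, hk, by simp⟩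
    refine Or.inr ⟨t + t', by positivity, (t / (t + t')) • k + (t' / (t + t')) • k',
      convex_convexHull ℝ S hk hk' (by positivity) (by positivity) (by field_simp), ?_⟩
    have : t + t' ≠ 0 := by positivity
    rw [smul_add, smul_smul, smul_smul, mul_div_cancel₀ _ this, mul_div_cancel₀ _ this]
  | smul a x _ hx =>
    rcases hx with rfl | ⟨t, ht, k, hk, rfl⟩
    · simp
    rcases eq_or_ne a 0 with rfl | ha
    · simp
    refine Or.inr ⟨a * t, mul_pos (by positivity) ht, k, hk, ?_⟩
    rw [mul_smul]
    rfl

end Cones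

/-! ### Edges of a polytope and the cone at a vertex. -/

section Edges

variable {E : Type*} [NormedAddCommGroup E] [InnerProductSpace ℝ E] {X : Set E}

theorem finrank_vectorSpan_segment {v w : E} (h : v ≠ w) :
    Module.finrank ℝ (vectorSpan ℝ (segment ℝ v w)) = 1 := by
  rw [← convexHull_pair, ← direction_affineSpan, affineSpan_convexHull, direction_affineSpan,
    vectorSpan_pair]
  exact finrank_span_singleton (by simpa [sub_eq_zero] using h)

/-- The directions from `v` to the other ends of the edges of `X` at `v`. -/
def edgeDirections (X : Set E) (v : E) : Set E :=
  {z | ∃ w ∈ X.exposedPoints ℝ, w ≠ v ∧ IsExposed ℝ X (segment ℝ v w) ∧ z = w - v}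

/-- A polytope is contained in the cone spanned by the edges at any of its vertices. -/
theorem IsFiniteHull.sub_mem_span_edgeDirections (hX : IsFiniteHull X) {v x : E}
    (hv : v ∈ X.exposedPoints ℝ) (hx : x ∈ X) :
    x - v ∈ Submodule.span ℝ≥0 (edgeDirections X v) := by
  obtain ⟨hvX, l, hl⟩ := id hv
  set C := Submodule.span ℝ≥0 (edgeDirections X v) with hC
  set V := X.exposedPoints ℝ with hV
  have hlt : ∀ w ∈ V, w ≠ v → 0 < l v - l w := fun w hw hne => by
    by_contra! h
    exact hne ((hl w hw.1).2 (by linarith))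
  -- The ray from v through w meets the hyperplane `l = l v - 1` in `q w`. The hull K of these
  -- points is a vertex figure; the task is to show that its vertices come from edges at v.
  let q : E → E := fun w => v + (l v - l w)⁻¹ • (w - v)
  have hq : ∀ w ∈ V, w ≠ v → w = v + (l v - l w) • (q w - v) := fun w hw hne => by
    have := (hlt w hw hne).ne'
    simp only [q, add_sub_cancel_left, smul_smul, mul_inv_cancel₀ this, one_smul]
    abel
  have hlq : ∀ w ∈ V, w ≠ v → l (q w) = l v - 1 := fun w hw hne => by
    have := (hlt w hw hne).ne'
    simp only [q, map_add, map_smul, map_sub, smul_eq_mul]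
    field_simp
    ring
  set K := convexHull ℝ (q '' (V \ {v})) with hKdef
  have hK : IsFiniteHull K := ⟨_, (hX.finite_exposedPoints.subset sdiff_subset).image q, rfl⟩
  have hKexp : ∀ k ∈ K.exposedPoints ℝ, k - v ∈ C := by
    intro k hk
    have hkim : k ∈ q '' (V \ {v}) :=
      extremePoints_convexHull_subset (exposedPoints_subset_extremePoints hk)
    obtain ⟨hkK, m, hm⟩ := hk
    let T : Set E := {w ∈ V | w ≠ v ∧ q w = k}
    have hTfin : T.Finite := hX.finite_exposedPoints.subset fun w hw => hw.1
    have hTne : T.Nonempty := by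
      obtain ⟨w, hw, rfl⟩ := hkim
      exact ⟨w, hw.1, hw.2, rfl⟩
    -- Several vertices may lie on the ray through k; the one with least `l` is farthest from v, so
    -- it is the other end of the edge.
    obtain ⟨w₀, ⟨hw₀V, hw₀v, hw₀k⟩, hmin⟩ := exists_min_image T l hTfin hTne
    -- Since `l k = l v - 1`, the coefficient makes `m' k = m' v`. So `m'` is constant on the ray
    -- through k and is smaller on every other ray to a vertex.
    set m' : StrongDual ℝ E := m + (m k - m v) • l with hm'
    have hm'w : ∀ w ∈ V, w ≠ v → m' w = m' v + (l v - l w) * (m (q w) - m k) := by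
      intro w hw hne
      have h1 : m' w = m' v + (l v - l w) * (m' (q w) - m' v) := by
        conv_lhs => rw [hq w hw hne]
        simp only [map_add, map_smul, map_sub, smul_eq_mul]
      rw [h1]
      congr 2
      simp only [hm', add_apply, smul_apply, smul_eq_mul, hlq w hw hne]
      ring
    have hqK : ∀ w ∈ V, w ≠ v → q w ∈ K := fun w hw hne =>
      subset_convexHull ℝ _ (mem_image_of_mem q ⟨hw, hne⟩)
    have hle : ∀ w ∈ V, m' w ≤ m' v := by
      intro w hw
      rcases eq_or_ne w v with rfl | hne
      · rfl
      rw [hm'w w hw hne]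
      have := hlt w hw hne
      nlinarith [(hm (q w) (hqK w hw hne)).1]
    have hle' : ∀ y ∈ X, m' y ≤ m' v := by
      intro y hy
      rw [← hX.convexHull_exposedPoints] at hy
      exact le_of_mem_convexHull m' hy hle
    have hseg : IsExposed ℝ X (segment ℝ v w₀) := by
      have hG := isExposed_setOf_eq m' hle'
      have hGeq : {x ∈ X | m' x = m' v} = segment ℝ v w₀ := by
        refine Subset.antisymm ?_ ((hG.convex hX.convex).segment_subset ⟨hvX, rfl⟩
          ⟨hw₀V.1, by rw [hm'w w₀ hw₀V hw₀v, hw₀k]; ring⟩)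
        rw [← hX.convexHull_face hG]
        refine convexHull_min ?_ (convex_segment _ _)
        rintro w ⟨hw, -, hwm⟩
        rcases eq_or_ne w v with rfl | hne
        · exact left_mem_segment ℝ _ _
        rw [hm'w w hw hne] at hwm
        have h0 := hlt w hw hne
        have hqk : q w = k := by
          refine (hm (q w) (hqK w hw hne)).2 ?_
          by_contra! h
          nlinarith
        have hlw := hmin w ⟨hw, hne, hqk⟩
        have h0' := hlt w₀ hw₀V hw₀v
        refine ⟨1 - (l v - l w) / (l v - l w₀), (l v - l w) / (l v - l w₀), ?_, by positivity,
          by ring, ?_⟩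
        · rw [sub_nonneg, div_le_one h0']
          linarith
        · have e1 := hq w hw hne
          have e2 := hq w₀ hw₀V hw₀v
          rw [hqk] at e1
          rw [hw₀k] at e2
          have : (l v - l w) = (l v - l w) / (l v - l w₀) * (l v - l w₀) := by
            field_simp
          rw [this, mul_smul] at e1
          have e3 : (l v - l w₀) • (k - v) = w₀ - v := by
            rw [eq_sub_iff_add_eq, add_comm]
            exact e2.symm
          rw [e3] at e1
          generalize (l v - l w) / (l v - l w₀) = r at e1
          rw [e1]
          module
      rwa [hGeq] at hG
    have hkv : k - v = (l v - l w₀)⁻¹ • (w₀ - v) := by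
      rw [← hw₀k]
      simp [q]
    rw [hkv]
    exact smul_mem_of_nonneg C (inv_nonneg.2 (hlt w₀ hw₀V hw₀v).le)
      (Submodule.subset_span ⟨w₀, hw₀V, hw₀v, hseg, rfl⟩)
  have hKC : ∀ k ∈ K, k - v ∈ C := by
    intro k hk
    rw [← hK.convexHull_exposedPoints] at hk
    exact convexHull_min (t := {x | x - v ∈ C}) hKexp (convex_setOf_sub_mem C v) hk
  rw [← hX.convexHull_exposedPoints] at hx
  refine convexHull_min (t := {x | x - v ∈ C}) (fun w hw => ?_) (convex_setOf_sub_mem C v) hx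
  change w - v ∈ C
  rcases eq_or_ne w v with rfl | hne
  · simp
  have e1 : w - v = (l v - l w) • (q w - v) := by
    rw [sub_eq_iff_eq_add, add_comm]
    exact hq w hw hne
  rw [e1]
  exact smul_mem_of_nonneg C (hlt w hw hne).le
    (hKC _ (subset_convexHull ℝ _ (mem_image_of_mem q ⟨hw, hne⟩)))

/-- A face of a polytope is contained in the cone spanned by its edges at any of its vertices. -/
theorem IsFiniteHull.sub_mem_span_face (hX : IsFiniteHull X) {v x : E} {G : Set E}
    (hv : v ∈ X.exposedPoints ℝ) (hG : IsExposed ℝ X G) (hvG : v ∈ G) (hx : x ∈ G) :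
    x - v ∈ Submodule.span ℝ≥0 {z ∈ edgeDirections X v | v + z ∈ G} := by
  obtain ⟨l, c, hlc, rfl⟩ := hG.exists_eq_setOf ⟨v, hvG⟩
  have h := map_nonpos_of_mem_span l (hX.sub_mem_span_edgeDirections hv hx.1) (by
    rintro _ ⟨w, hw, -, -, rfl⟩
    rw [map_sub, hvG.2]
    linarith [hlc w hw.1])
  refine Submodule.span_mono ?_ (h.2 (by rw [map_sub, hvG.2, hx.2, sub_self]))
  rintro _ ⟨⟨w, hw, hwv, hwe, rfl⟩, h0⟩
  refine ⟨⟨w, hw, hwv, hwe, rfl⟩, by simpa using hw.1, ?_⟩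
  rw [map_add, h0, add_zero, hvG.2]

/-- A face is the hull of its vertices, so one of dimension one has two, v and w. A point of the
line beyond either would put that vertex inside an open segment of X. -/
theorem IsEdgeOf.exists_segment (hX : IsFiniteHull X) {e : Set E} (he : IsEdgeOf X e) :
    ∃ v ∈ X.exposedPoints ℝ, ∃ w ∈ X.exposedPoints ℝ, v ≠ w ∧ e = segment ℝ v w := by
  obtain ⟨hexp, hrank⟩ := he
  have hne : e.Nonempty := by
    rw [nonempty_iff_ne_empty]
    rintro rfl
    rw [vectorSpan_empty, finrank_bot] at hrank
    exact zero_ne_one hrank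
  obtain ⟨v, hv, hve⟩ := hX.exists_exposedPoint hexp hne
  have : ∃ w ∈ X.exposedPoints ℝ, w ∈ e ∧ w ≠ v := by
    by_contra! h
    have h1 := hX.convexHull_face hexp
    have h2 : X.exposedPoints ℝ ∩ e = {v} := by
      ext z
      constructor
      · rintro ⟨hz, hze⟩
        exact h z hz hze
      · rintro rfl
        exact ⟨hv, hve⟩
    rw [h2, convexHull_singleton] at h1
    rw [← h1, vectorSpan_singleton, finrank_bot] at hrank
    exact zero_ne_one hrank
  obtain ⟨w, hw, hwe, hwv⟩ := this
  refine ⟨v, hv, w, hw, hwv.symm, Subset.antisymm ?_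
    ((hexp.convex hX.convex).segment_subset hve hwe)⟩
  intro p hp
  have hwmem : w - v ∈ vectorSpan ℝ e := vsub_mem_vectorSpan ℝ hwe hve
  have hpmem : p - v ∈ vectorSpan ℝ e := vsub_mem_vectorSpan ℝ hp hve
  obtain ⟨t, ht⟩ := (finrank_eq_one_iff_of_nonzero' (⟨w - v, hwmem⟩ : vectorSpan ℝ e)
    (by simpa [Subtype.ext_iff, sub_eq_zero] using hwv)).1 hrank ⟨p - v, hpmem⟩
  have ht : t • (w - v) = p - v := congrArg Subtype.val ht
  have hp' : p = v + t • (w - v) := by rw [ht]; abel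
  have hvext : v ∈ X.extremePoints ℝ := exposedPoints_subset_extremePoints hv
  have hwext : w ∈ X.extremePoints ℝ := exposedPoints_subset_extremePoints hw
  have hpX := hexp.subset hp
  have ht0 : 0 ≤ t := by
    by_contra! h
    have h1 : (0:ℝ) < 1 - t := by linarith
    have hmem : v ∈ openSegment ℝ w p := by
      refine ⟨-t / (1 - t), 1 / (1 - t), div_pos (by linarith) h1, by positivity, ?_, ?_⟩
      · field_simp; ring
      · rw [hp']
        have h2 : (-t / (1 - t)) = 1 - 1 / (1 - t) := by field_simp; ring
        have h3 : (1 / (1 - t)) * (1 - t) = 1 := by field_simp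
        have : (-t / (1 - t)) • w + (1 / (1 - t)) • (v + t • (w - v)) =
          ((1 / (1 - t)) * (1 - t)) • v + (1 - (1 / (1 - t)) * (1 - t)) • w := by
          rw [h2]; module
        rw [this, h3]; simp
    exact hwv ((mem_extremePoints.1 hvext).2 w hw.1 p hpX hmem).1
  have ht1 : t ≤ 1 := by
    by_contra! h
    have hmem : w ∈ openSegment ℝ v p := by
      have h0 : 0 < t := by linarith
      refine ⟨1 - 1 / t, 1 / t, ?_, by positivity, by ring, ?_⟩
      · rw [sub_pos, div_lt_one h0]; exact h
      · rw [hp']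
        have h3 : (1 / t) * t = 1 := by field_simp
        have : (1 - 1 / t) • v + (1 / t) • (v + t • (w - v)) =
          v + ((1 / t) * t) • (w - v) := by module
        rw [this, h3]; simp
    exact hwv ((mem_extremePoints.1 hwext).2 v hv.1 p hpX hmem).1.symm
  exact ⟨1 - t, t, by linarith, ht0, by ring, by rw [hp']; module⟩

end Edges

/-! ### Edges in the face lattice, and how they determine faces and intervals. -/

section FaceLattices

variable {E : Type*} [NormedAddCommGroup E] [InnerProductSpace ℝ E] {X : Set E}

theorem isEdgeOf_segment {v w : E} (hvw : v ≠ w) (h : IsExposed ℝ X (segment ℝ v w)) :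
    IsEdgeOf X (segment ℝ v w) :=
  ⟨h, finrank_vectorSpan_segment hvw⟩

theorem eq_or_eq_of_mem_exposedPoints_of_mem_segment {v a b : E} (hv : v ∈ X.exposedPoints ℝ)
    (ha : a ∈ X) (hb : b ∈ X) (h : v ∈ segment ℝ a b) : v = a ∨ v = b := by
  have := (mem_extremePoints_iff_forall_segment.1 (exposedPoints_subset_extremePoints hv)).2
    a ha b hb h
  tauto

theorem isExposed_singleton {v : E} (hv : v ∈ X.exposedPoints ℝ) : IsExposed ℝ X {v} :=
  mem_exposedPoints_iff_exposed_singleton.1 hv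

/-- The only vertices on an edge are its ends, and a face containing both contains the edge. This
makes the lower end of any interval in E₁ either ∅ or a vertex. -/
theorem IsEdgeOf.exists_exposedPoint_of_ssubset (hX : IsFiniteHull X) {e G : Set E}
    (he : IsEdgeOf X e) (hG : IsExposed ℝ X G) (h : G ⊂ e) :
    ∃ v ∈ X.exposedPoints ℝ, v ∈ e ∧ G ⊆ {v} := by
  obtain ⟨v, hv, w, hw, hvw, rfl⟩ := he.exists_segment hX
  have key : ∀ a b : E, a ∈ X.exposedPoints ℝ → b ∈ X.exposedPoints ℝ → G ⊂ segment ℝ a b →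
      b ∉ G → G ⊆ {a} := by
    intro a b ha hb hab hbG
    rw [← hX.convexHull_face hG]
    refine convexHull_min ?_ (convex_singleton a)
    rintro z ⟨hz, hzG⟩
    rcases eq_or_eq_of_mem_exposedPoints_of_mem_segment hz ha.1 hb.1 (hab.1 hzG) with h | h
    · exact h
    · exact absurd (h ▸ hzG) hbG
  by_cases hwG : w ∈ G
  · refine ⟨w, hw, right_mem_segment ℝ v w, key w v hw hv (by rwa [segment_symm]) fun hvG => ?_⟩
    exact h.2 ((hG.convex hX.convex).segment_subset hvG hwG)
  · exact ⟨v, hv, left_mem_segment ℝ v w, key v w hv hw h hwG⟩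

theorem IsEdgeOf.eq_of_subset (hX : IsFiniteHull X) {e e' : Set E} (he : IsEdgeOf X e)
    (he' : IsEdgeOf X e') (h : e ⊆ e') : e = e' := by
  by_contra hne
  obtain ⟨a, -, -, hsub⟩ := he'.exists_exposedPoint_of_ssubset hX he.1 (h.ssubset_of_ne hne)
  obtain ⟨v, hv, w, hw, hvw, rfl⟩ := he.exists_segment hX
  exact hvw ((hsub (left_mem_segment ℝ v w)).trans (hsub (right_mem_segment ℝ v w)).symm)

theorem IsEdgeOf.eq_segment_of_mem (hX : IsFiniteHull X) {e : Set E} (he : IsEdgeOf X e) {v : E}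
    (hv : v ∈ X.exposedPoints ℝ) (hve : v ∈ e) :
    ∃ w ∈ X.exposedPoints ℝ, w ≠ v ∧ e = segment ℝ v w := by
  obtain ⟨a, ha, b, hb, hab, rfl⟩ := he.exists_segment hX
  rcases eq_or_eq_of_mem_exposedPoints_of_mem_segment hv ha.1 hb.1 hve with rfl | rfl
  · exact ⟨b, hb, hab.symm, rfl⟩
  · exact ⟨a, ha, hab, segment_symm ℝ a v⟩

theorem IsEdgeOf.inter_subset_singleton (hX : IsFiniteHull X) {e e' : Set E} (he : IsEdgeOf X e)
    (he' : IsEdgeOf X e') (hne : e ≠ e') {v : E} (hv : v ∈ e) (hv' : v ∈ e') :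
    e ∩ e' ⊆ {v} := by
  have hss : e ∩ e' ⊂ e := by
    refine inter_subset_left.ssubset_of_ne fun h => hne ?_
    exact he.eq_of_subset hX he' (inter_eq_left.1 h)
  obtain ⟨a, -, -, hsub⟩ := he.exists_exposedPoint_of_ssubset hX (he.1.inter he'.1) hss
  have : v = a := hsub ⟨hv, hv'⟩
  rwa [this]

/-- A face is determined by its edges at any of its vertices. -/
theorem IsFiniteHull.face_subset_of_edges (hX : IsFiniteHull X) {G H : Set E} {v : E}
    (hG : IsExposed ℝ X G) (hH : IsExposed ℝ X H) (hv : v ∈ X.exposedPoints ℝ) (hvG : v ∈ G)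
    (hvH : v ∈ H) (h : ∀ e, IsEdgeOf X e → v ∈ e → e ⊆ G → e ⊆ H) : G ⊆ H := by
  intro x hx
  have hmem := hX.sub_mem_span_face hv hG hvG hx
  obtain ⟨l, c, hlc, rfl⟩ := hH.exists_eq_setOf ⟨v, hvH⟩
  have hz : ∀ z ∈ {z ∈ edgeDirections X v | v + z ∈ G}, l z = 0 := by
    rintro _ ⟨⟨w, hw, hwv, hwe, rfl⟩, hwG⟩
    rw [add_sub_cancel] at hwG
    have := h _ (isEdgeOf_segment hwv.symm hwe) (left_mem_segment ℝ v w)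
      ((hG.convex hX.convex).segment_subset hvG hwG) (right_mem_segment ℝ v w)
    rw [map_sub, this.2, hvH.2, sub_self]
  -- Applying the sign lemma to `l` and to `-l` shows that `l` vanishes on the whole cone.
  have h1 := (map_nonpos_of_mem_span l hmem fun z hz' => (hz z hz').le).1
  have h2 := (map_nonpos_of_mem_span (-l) hmem fun z hz' => by simp [hz z hz']).1
  rw [neg_apply, map_sub, hvH.2] at h2
  rw [map_sub, hvH.2] at h1
  exact ⟨hG.subset hx, by linarith⟩

theorem IsFiniteHull.exists_edge_not_subset (hX : IsFiniteHull X) {G H : Set E} {v : E}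
    (hG : IsExposed ℝ X G) (hH : IsExposed ℝ X H) (hv : v ∈ X.exposedPoints ℝ) (hvG : v ∈ G)
    (hvH : v ∈ H) (h : ¬ G ⊆ H) : ∃ e, IsEdgeOf X e ∧ v ∈ e ∧ e ⊆ G ∧ ¬ e ⊆ H := by
  by_contra! h'
  exact h (hX.face_subset_of_edges hG hH hv hvG hvH h')

theorem height_le_one_of_subset_singleton {z : FaceLattice X} {v : E} (h : z.1 ⊆ {v}) :
    Order.height z ≤ ((1 : ℕ) : ℕ∞) := by
  rw [Order.height_le_coe_iff]
  intro z' hz'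
  have h0 : z'.1 = ∅ := by
    rcases subset_singleton_iff_eq.1 h with h0 | h0
    · exact absurd (show z ≤ z' from fun x hx => by simp [h0] at hx) hz'.not_ge
    · rcases subset_singleton_iff_eq.1 (Subset.trans (show z'.1 ⊆ z.1 from hz'.le) h) with h1 | h1
      · exact h1
      · exact absurd (show z ≤ z' from (h0.trans h1.symm).subset) hz'.not_ge
  have : Order.height z' = 0 := by
    rw [Order.height_eq_zero]
    intro a _ x hx
    rw [h0] at hx
    exact absurd hx (notMem_empty x)
  rw [this]
  exact_mod_cast one_pos

theorem IsEdgeOf.height_eq (hX : IsFiniteHull X) {y : FaceLattice X} (hy : IsEdgeOf X y.1) :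
    Order.height y = ((1 + 1 : ℕ) : ℕ∞) := by
  refine le_antisymm ?_ ?_
  · rw [Order.height_le_coe_iff]
    intro z hz
    obtain ⟨v, -, -, hsub⟩ := hy.exists_exposedPoint_of_ssubset hX z.2 hz
    exact (height_le_one_of_subset_singleton hsub).trans_lt (by exact_mod_cast Nat.lt_succ_self 1)
  · obtain ⟨v, hv, w, hw, hvw, heq⟩ := hy.exists_segment hX
    let b : FaceLattice X := ⟨∅, isExposed_empty⟩
    let p : FaceLattice X := ⟨{v}, isExposed_singleton hv⟩
    have h1 : b < p := by
      refine lt_of_le_not_ge (empty_subset _) fun h => ?_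
      exact (h (mem_singleton v) : v ∈ (∅ : Set E))
    have h2 : p < y := by
      refine lt_of_le_not_ge (singleton_subset_iff.2 ?_) fun h => hvw ?_
      · rw [heq]
        exact left_mem_segment ℝ v w
      · exact (h (by rw [heq]; exact right_mem_segment ℝ v w) : w ∈ ({v} : Set E)).symm
    have h3 := Order.height_add_one_le h1
    have h4 := Order.height_add_one_le h2
    calc ((1 + 1 : ℕ) : ℕ∞) = 0 + 1 + 1 := by norm_num
      _ ≤ Order.height b + 1 + 1 := by gcongr; exact zero_le
      _ ≤ Order.height p + 1 := by gcongr
      _ ≤ Order.height y := h4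

/-- The edges of a polytope are its faces of rank two. -/
theorem height_eq_two_iff (hX : IsFiniteHull X) {y : FaceLattice X} :
    Order.height y = ((1 + 1 : ℕ) : ℕ∞) ↔ IsEdgeOf X y.1 := by
  refine ⟨fun h => ?_, fun h => h.height_eq hX⟩
  -- Rank two excludes ∅ and points, so the face contains an edge; that edge already has rank two,
  -- which rules out strict inclusion.
  have hnot : ∀ v : E, ¬ y.1 ⊆ {v} := fun v hv => by
    have := height_le_one_of_subset_singleton hv
    rw [h] at this
    exact absurd this (by norm_num)
  have hne : y.1.Nonempty := by
    rw [nonempty_iff_ne_empty]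
    intro h0
    exact hnot 0 (by rw [h0]; exact empty_subset _)
  obtain ⟨v, hv, hvy⟩ := hX.exists_exposedPoint y.2 hne
  obtain ⟨e, he, -, hey, -⟩ := hX.exists_edge_not_subset y.2 (isExposed_singleton hv) hv hvy
    (mem_singleton v) (hnot v)
  let e' : FaceLattice X := ⟨e, he.1⟩
  rcases (show e' ≤ y from hey).eq_or_lt with heq | hlt
  · rw [← heq]
    exact he
  · have h1 := Order.height_add_one_le hlt
    rw [IsEdgeOf.height_eq hX (y := e') he, h] at h1
    exact absurd h1 (by norm_num)

variable {x y z x' z' : FaceLattice X}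

/-- The face x lies in some vertex v of y, so every edge of z at v lies above x; these edges
determine z. -/
theorem FaceLattice.le_of_forall_edges_le (hX : IsFiniteHull X) (hy : IsEdgeOf X y.1) (hxy : x < y)
    (hyz : y < z) (h : ∀ e : FaceLattice X, IsEdgeOf X e.1 → x ≤ e → e ≤ z → e ≤ z') : z ≤ z' := by
  obtain ⟨v, hv, hvy, hxv⟩ := hy.exists_exposedPoint_of_ssubset hX x.2 hxy
  refine hX.face_subset_of_edges z.2 z'.2 hv (hyz.le hvy) (h y hy hxy.le hyz.le hvy) ?_
  intro e he hve hez
  exact h ⟨e, he.1⟩ he (hxv.trans (singleton_subset_iff.2 hve)) hez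

/-- As y is a proper face of z, a second edge of z leaves v and meets y only there, which forces x'
into {v}. If x is empty this applies at both ends of y, so x' is empty too. -/
theorem FaceLattice.le_of_forall_le_edges (hX : IsFiniteHull X) (hy : IsEdgeOf X y.1) (hxy : x < y)
    (hyz : y < z) (h : ∀ e : FaceLattice X, IsEdgeOf X e.1 → x ≤ e → e ≤ z → x' ≤ e) : x' ≤ x := by
  have key : ∀ v ∈ X.exposedPoints ℝ, v ∈ y.1 → x.1 ⊆ {v} → x'.1 ⊆ {v} := by
    intro v hv hvy hxv
    obtain ⟨e, he, hve, hez, hey⟩ := hX.exists_edge_not_subset z.2 y.2 hv (hyz.le hvy) hvy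
      hyz.not_ge
    refine Subset.trans (subset_inter (h y hy hxy.le hyz.le)
      (h ⟨e, he.1⟩ he (hxv.trans (singleton_subset_iff.2 hve)) hez)) ?_
    exact hy.inter_subset_singleton hX he (fun h => hey h.symm.subset) hvy hve
  obtain ⟨v, hv, hvy, hxv⟩ := hy.exists_exposedPoint_of_ssubset hX x.2 hxy
  rcases subset_singleton_iff_eq.1 hxv with h0 | h0
  · obtain ⟨w, hw, hwv, heq⟩ := hy.eq_segment_of_mem hX hv hvy
    have h1 := key v hv hvy hxv
    have h2 := key w hw (by rw [heq]; exact right_mem_segment ℝ v w) (by simp [h0])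
    intro a ha
    exact absurd ((h2 ha).symm.trans (h1 ha)) hwv
  · change x'.1 ⊆ x.1
    rw [h0]
    exact key v hv hvy hxv

/-- The edges belonging to a set of faces. -/
def edgesIn (S : Set (FaceLattice X)) : Set (FaceLattice X) := {y ∈ S | IsEdgeOf X y.1}

/-- The elements of `E₁(L(X))` are determined by the edges they contain. -/
theorem subset_iff_edgesIn_subset (hX : IsFiniteHull X) {S S' : Set (FaceLattice X)}
    (hS : IsEtElement 1 S) (hS' : IsEtElement 1 S') : edgesIn S ⊆ edgesIn S' ↔ S ⊆ S' := by
  refine ⟨fun h => ?_, fun h y hy => ⟨h hy.1, hy.2⟩⟩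
  rcases hS with rfl | ⟨y, hy, rfl⟩ | ⟨x, z, rfl, y, hy, hxy, hyz⟩
  · exact empty_subset _
  · rw [height_eq_two_iff hX] at hy
    exact singleton_subset_iff.2 (h ⟨mem_singleton y, hy⟩).1
  rw [height_eq_two_iff hX] at hy
  have hE : ∀ e : FaceLattice X, IsEdgeOf X e.1 → x ≤ e → e ≤ z → e ∈ S' := fun e he h1 h2 =>
    (h ⟨⟨h1, h2⟩, he⟩).1
  rcases hS' with rfl | ⟨y', hy', rfl⟩ | ⟨x', z', rfl, -⟩
  · exact absurd (hE y hy hxy.le hyz.le) (notMem_empty y)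
  · rw [height_eq_two_iff hX] at hy'
    -- An interval of E₁ cannot have y' as its only edge: its top z would then lie in y', leaving no
    -- room for y < z.
    have hz : z ≤ y' := FaceLattice.le_of_forall_edges_le hX hy hxy hyz
      fun e he h1 h2 => (hE e he h1 h2 : e = y').le
    have := hy.eq_of_subset hX hy' (hyz.le.trans hz)
    exact absurd (hyz.trans_le hz) (by rw [show y = y' from Subtype.ext this]; exact lt_irrefl y')
  · exact Icc_subset_Icc
      (FaceLattice.le_of_forall_le_edges hX hy hxy hyz fun e he h1 h2 => (hE e he h1 h2).1)
      (FaceLattice.le_of_forall_edges_le hX hy hxy hyz fun e he h1 h2 => (hE e he h1 h2).2)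

end FaceLattices

/-! ### Functoriality of E_t and comparison of ranges. -/

section EtPosets

theorem IsEtElement.image {L L' : Type*} [PartialOrder L] [PartialOrder L'] (f : L ≃o L') {t : ℕ}
    {S : Set L} (hS : IsEtElement t S) : IsEtElement t (f '' S) := by
  rcases hS with rfl | ⟨y, hy, rfl⟩ | ⟨x, z, rfl, y, hy, hxy, hyz⟩
  · exact Or.inl (image_empty f)
  · exact Or.inr (Or.inl ⟨f y, by rwa [Order.height_orderIso], image_singleton⟩)
  · exact Or.inr (Or.inr ⟨f x, f z, f.image_Icc x z, f y, by rwa [Order.height_orderIso],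
      f.lt_iff_lt.2 hxy, f.lt_iff_lt.2 hyz⟩)

/-- The poset `E_t(L)` depends functorially on `L` under isomorphisms. -/
def EtPoset.congr {L L' : Type*} [PartialOrder L] [PartialOrder L'] (f : L ≃o L') (t : ℕ) :
    {S : Set L // IsEtElement t S} ≃o {S : Set L' // IsEtElement t S} where
  toFun S := ⟨f '' S.1, S.2.image f⟩
  invFun S := ⟨f.symm '' S.1, S.2.image f.symm⟩
  left_inv S := Subtype.ext (f.symm_image_image S.1)
  right_inv S := Subtype.ext (f.image_symm_image S.1)
  map_rel_iff' := image_subset_image_iff f.injective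

theorem nonempty_orderIso_of_range_eq {α β γ : Type*} [PartialOrder α] [PartialOrder β]
    [PartialOrder γ] (f : α ↪o γ) (g : β ↪o γ) (h : range f = range g) : Nonempty (α ≃o β) :=
  ⟨f.orderIso.trans ((OrderIso.setCongr _ _ h).trans g.orderIso.symm)⟩

end EtPosets

/-! ### Polar duality relative to a relative interior point. -/

section PolarDuality

variable {E : Type*} [NormedAddCommGroup E] [InnerProductSpace ℝ E] {D : Set E} {o : E}

theorem isExposed_setOf_forall_eq {X : Set E} {ι : Type*} {t : Set ι} (ht : t.Finite)
    (l : ι → StrongDual ℝ E) (c : ι → ℝ) (h : ∀ i ∈ t, ∀ y ∈ X, l i y ≤ c i) :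
    IsExposed ℝ X {x ∈ X | ∀ i ∈ t, l i x = c i} := by
  induction t, ht using Set.Finite.induction_on with
  | empty => simpa using IsExposed.refl X
  | @insert a s _ _ ih =>
    have h1 := ih fun i hi => h i (mem_insert_of_mem a hi)
    have h2 := isExposed_setOf_eq (l a) (h a (mem_insert a s))
    have heq : {x ∈ X | ∀ i ∈ insert a s, l i x = c i} =
        {x ∈ X | l a x = c a} ∩ {x ∈ X | ∀ i ∈ s, l i x = c i} := by
      ext x
      constructor
      · rintro ⟨hx, h⟩
        exact ⟨⟨hx, h a (mem_insert a s)⟩, hx, fun i hi => h i (mem_insert_of_mem a hi)⟩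
      · rintro ⟨⟨hx, ha⟩, -, hs⟩
        exact ⟨hx, forall_mem_insert.2 ⟨ha, hs⟩⟩
    rw [heq]
    exact h2.inter h1

variable [FiniteDimensional ℝ E]

theorem exists_mem_inner_eq (V : Submodule ℝ E) (l : StrongDual ℝ E) :
    ∃ a ∈ V, ∀ v ∈ V, inner ℝ a v = l v := by
  let a : V := (InnerProductSpace.toDual ℝ V).symm (l.comp V.subtypeL)
  refine ⟨a, a.2, fun v hv => ?_⟩
  have := InnerProductSpace.toDual_symm_apply (𝕜 := ℝ) (x := (⟨v, hv⟩ : V))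
    (y := l.comp V.subtypeL)
  rw [Submodule.coe_inner] at this
  exact this

omit [FiniteDimensional ℝ E] in
theorem exists_pos_forall_add_mem (ho : o ∈ intrinsicInterior ℝ D) :
    ∃ r > 0, ∀ v ∈ vectorSpan ℝ D, ‖v‖ < r → o + v ∈ D := by
  obtain ⟨y, hy, rfl⟩ := mem_intrinsicInterior.1 ho
  rw [mem_interior_iff_mem_nhds, Metric.mem_nhds_iff] at hy
  obtain ⟨r, hr, hball⟩ := hy
  refine ⟨r, hr, fun v hv hvr => ?_⟩
  rw [← direction_affineSpan] at hv
  have hmem : (y : E) + v ∈ affineSpan ℝ D := by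
    rw [add_comm]
    exact AffineSubspace.vadd_mem_of_mem_direction hv y.2
  have : (⟨(y : E) + v, hmem⟩ : affineSpan ℝ D) ∈ Metric.ball y r := by
    rw [Metric.mem_ball, Subtype.dist_eq, dist_eq_norm]
    simpa using hvr
  exact hball this

omit [FiniteDimensional ℝ E] in
theorem exists_pos_smul_norm_lt (v : E) {r : ℝ} (hr : 0 < r) : ∃ ε > (0 : ℝ), ‖ε • v‖ < r := by
  refine ⟨r / (‖v‖ + 1), by positivity, ?_⟩
  rw [norm_smul, Real.norm_of_nonneg (by positivity), div_mul_eq_mul_div,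
    div_lt_iff₀ (by positivity)]
  nlinarith [norm_nonneg v]

omit [FiniteDimensional ℝ E] in
theorem exists_pos_add_smul_mem (ho : o ∈ intrinsicInterior ℝ D) {v : E}
    (hv : v ∈ vectorSpan ℝ D) : ∃ ε > (0 : ℝ), o + ε • v ∈ D := by
  obtain ⟨r, hr, h⟩ := exists_pos_forall_add_mem ho
  obtain ⟨ε, hε, hlt⟩ := exists_pos_smul_norm_lt v hr
  exact ⟨ε, hε, h _ (Submodule.smul_mem _ ε hv) hlt⟩

omit [FiniteDimensional ℝ E] in
theorem sub_mem_vectorSpan (ho : o ∈ intrinsicInterior ℝ D) {x : E} (hx : x ∈ D) :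
    x - o ∈ vectorSpan ℝ D :=
  vsub_mem_vectorSpan ℝ hx (intrinsicInterior_subset ho)

omit [FiniteDimensional ℝ E] in
theorem zero_mem_polarAt : (0 : E) ∈ polarAt D o :=
  ⟨zero_mem _, fun x _ => by simp⟩

/-- D contains a relative ball about o; testing a polar vector y against a short multiple of itself
bounds its norm. -/
theorem isCompact_polarAt (ho : o ∈ intrinsicInterior ℝ D) : IsCompact (polarAt D o) := by
  refine Metric.isCompact_of_isClosed_isBounded ?_ ?_
  · have : polarAt D o = (vectorSpan ℝ D : Set E) ∩ ⋂ x ∈ D, {y | inner ℝ y (x - o) ≤ 1} := by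
      ext y
      simp [polarAt]
    rw [this]
    refine (Submodule.closed_of_finiteDimensional _).inter (isClosed_biInter fun x _ => ?_)
    exact isClosed_le (by fun_prop) continuous_const
  · obtain ⟨r, hr, h⟩ := exists_pos_forall_add_mem ho
    refine isBounded_iff_forall_norm_le.2 ⟨2 / r, fun y hy => ?_⟩
    rcases eq_or_ne y 0 with rfl | h0
    · simp only [norm_zero]; positivity
    have hy0 : 0 < ‖y‖ := norm_pos_iff.2 h0
    have hn : ‖(r / 2 / ‖y‖) • y‖ = r / 2 := by
      rw [norm_smul, Real.norm_of_nonneg (by positivity)]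
      field_simp
    have h1 := hy.2 _ (h _ (Submodule.smul_mem _ (r / 2 / ‖y‖) hy.1) (by rw [hn]; linarith))
    rw [add_sub_cancel_left, real_inner_smul_right, real_inner_self_eq_norm_sq] at h1
    have h2 : r / 2 / ‖y‖ * ‖y‖ ^ 2 = r / 2 * ‖y‖ := by field_simp
    rw [h2] at h1
    rw [le_div_iff₀ hr]
    linarith

omit [FiniteDimensional ℝ E] in
theorem convex_polarAt : Convex ℝ (polarAt D o) := by
  intro y hy z hz a b ha hb hab
  refine ⟨Submodule.add_mem _ (Submodule.smul_mem _ _ hy.1) (Submodule.smul_mem _ _ hz.1),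
    fun x hx => ?_⟩
  rw [inner_add_left, real_inner_smul_left, real_inner_smul_left]
  nlinarith [hy.2 x hx, hz.2 x hx]

omit [FiniteDimensional ℝ E] in
theorem mem_polarAt_of_convexHull {s : Set E} (hs : D = convexHull ℝ s) {y : E}
    (hy : y ∈ vectorSpan ℝ D) (h : ∀ x ∈ s, inner ℝ y (x - o) ≤ 1) : y ∈ polarAt D o := by
  refine ⟨hy, fun x hx => ?_⟩
  rw [hs] at hx
  have := le_of_mem_convexHull (innerSL ℝ y) hx (c := 1 + inner ℝ y o) fun z hz => by
    have := h z hz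
    rw [inner_sub_right] at this
    rw [innerSL_apply_apply]
    linarith
  rw [innerSL_apply_apply] at this
  rw [inner_sub_right]
  linarith

omit [FiniteDimensional ℝ E] in
-- An extreme point is determined by the generators of D at which its inequality is tight: if y and
-- y' share these, y can move both ways along y - y' without leaving the polar.
theorem finite_extremePoints_polarAt (hD : IsFiniteHull D) :
    ((polarAt D o).extremePoints ℝ).Finite := by
  obtain ⟨s, hs, hDs⟩ := hD
  refine Set.Finite.of_injOn (f := fun y => {x ∈ s | inner ℝ y (x - o) = 1}) (t := 𝒫 s)
    (fun y _ x hx => hx.1) ?_ hs.finite_subsets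
  intro y hy y' hy' heq
  have hsD : s ⊆ D := hDs ▸ subset_convexHull ℝ s
  have hd : y - y' ∈ vectorSpan ℝ D := Submodule.sub_mem _ hy.1.1 hy'.1.1
  have hev : ∀ᶠ ε in 𝓝[>] (0 : ℝ), ∀ x ∈ s, inner ℝ (y + ε • (y - y')) (x - o) ≤ 1 ∧
      inner ℝ (y - ε • (y - y')) (x - o) ≤ 1 := by
    rw [Filter.eventually_all_finite hs]
    intro x hx
    rcases (hy.1.2 x (hsD hx)).eq_or_lt with h | h
    · have hx' : x ∈ {x ∈ s | inner ℝ y' (x - o) = 1} := by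
        have heq' : {x ∈ s | inner ℝ y (x - o) = 1} = {x ∈ s | inner ℝ y' (x - o) = 1} := heq
        rw [← heq']
        exact ⟨hx, h⟩
      have h0 : inner ℝ (y - y') (x - o) = 0 := by
        rw [inner_sub_left, h, hx'.2, sub_self]
      refine Eventually.of_forall fun ε => ?_
      rw [inner_add_left, inner_sub_left y, real_inner_smul_left, h0, h]
      simp
    · refine eventually_nhdsWithin_of_eventually_nhds ?_
      have c1 : Continuous fun ε : ℝ => inner ℝ (y + ε • (y - y')) (x - o) := by fun_prop
      have c2 : Continuous fun ε : ℝ => inner ℝ (y - ε • (y - y')) (x - o) := by fun_prop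
      have e1 := (c1.tendsto 0).eventually_lt_const (u := 1) (by simpa using h)
      have e2 := (c2.tendsto 0).eventually_lt_const (u := 1) (by simpa using h)
      filter_upwards [e1, e2] with ε h1 h2 using ⟨h1.le, h2.le⟩
  obtain ⟨ε, hε, hpos⟩ := (hev.and self_mem_nhdsWithin).exists
  have m1 : y + ε • (y - y') ∈ polarAt D o := mem_polarAt_of_convexHull hDs
    (Submodule.add_mem _ hy.1.1 (Submodule.smul_mem _ _ hd)) fun x hx => (hε x hx).1
  have m2 : y - ε • (y - y') ∈ polarAt D o := mem_polarAt_of_convexHull hDs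
    (Submodule.sub_mem _ hy.1.1 (Submodule.smul_mem _ _ hd)) fun x hx => (hε x hx).2
  have hmem : y ∈ openSegment ℝ (y + ε • (y - y')) (y - ε • (y - y')) :=
    ⟨1 / 2, 1 / 2, by norm_num, by norm_num, by norm_num, by module⟩
  have h := ((mem_extremePoints.1 hy).2 _ m1 _ m2 hmem).1
  rw [add_eq_left, smul_eq_zero] at h
  rcases h with h | h
  · exact absurd h (ne_of_gt hpos)
  · exact sub_eq_zero.1 h

theorem isFiniteHull_polarAt (hD : IsFiniteHull D) (ho : o ∈ intrinsicInterior ℝ D) :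
    IsFiniteHull (polarAt D o) :=
  ⟨_, finite_extremePoints_polarAt hD, ((isCompact_polarAt ho).convexHull_extremePoints_eq
    convex_polarAt (finite_extremePoints_polarAt hD)).symm⟩

omit [FiniteDimensional ℝ E] in
theorem exists_pos_smul_mem_polarAt (hD : IsFiniteHull D) {v : E} (hv : v ∈ vectorSpan ℝ D) :
    ∃ ε > (0 : ℝ), ε • v ∈ polarAt D o := by
  have hc : ContinuousOn (fun x => inner ℝ v (x - o)) D := by fun_prop
  obtain ⟨M, hM⟩ := hD.isCompact.bddAbove_image hc
  refine ⟨(max M 1)⁻¹, by positivity, Submodule.smul_mem _ _ hv, fun x hx => ?_⟩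
  rw [real_inner_smul_left, inv_mul_le_one₀ (by positivity)]
  exact (hM (mem_image_of_mem _ hx)).trans (le_max_left M 1)

omit [FiniteDimensional ℝ E] in
theorem vectorSpan_polarAt (hD : IsFiniteHull D) :
    vectorSpan ℝ (polarAt D o) = vectorSpan ℝ D := by
  refine le_antisymm ?_ fun v hv => ?_
  · rw [vectorSpan_def, Submodule.span_le]
    rintro _ ⟨y, hy, z, hz, rfl⟩
    exact Submodule.sub_mem _ hy.1 hz.1
  · obtain ⟨ε, hε, h⟩ := exists_pos_smul_mem_polarAt (o := o) hD hv
    have := vsub_mem_vectorSpan ℝ h (zero_mem_polarAt (D := D) (o := o))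
    rw [vsub_eq_sub, sub_zero] at this
    exact (Submodule.smul_mem_iff _ hε.ne').1 this

theorem IsDPolytope.polarAt {d : ℕ} (hD : IsDPolytope d D) (ho : o ∈ intrinsicInterior ℝ D) :
    IsDPolytope d (polarAt D o) :=
  (isFiniteHull_polarAt hD.isFiniteHull ho).isDPolytope ⟨0, zero_mem_polarAt⟩
    (by rw [vectorSpan_polarAt hD.isFiniteHull]; exact hD.2)

/-- This is the bipolar theorem: a functional separating x from D, represented in the direction
space and scaled by its gap at o, is a polar vector that x violates. -/
theorem mem_of_forall_polarAt (hD : IsFiniteHull D) (ho : o ∈ intrinsicInterior ℝ D) {x : E}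
    (hx : x - o ∈ vectorSpan ℝ D) (h : ∀ y ∈ polarAt D o, inner ℝ y (x - o) ≤ 1) : x ∈ D := by
  by_contra hxD
  obtain ⟨l, u, hlu, hux⟩ :=
    geometric_hahn_banach_closed_point hD.convex hD.isCompact.isClosed hxD
  obtain ⟨a, ha, hal⟩ := exists_mem_inner_eq (vectorSpan ℝ D) l
  have h0 : 0 < u - l o := sub_pos.2 (hlu o (intrinsicInterior_subset ho))
  have hmem : (u - l o)⁻¹ • a ∈ polarAt D o := by
    refine ⟨Submodule.smul_mem _ _ ha, fun z hz => ?_⟩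
    rw [real_inner_smul_left, hal _ (sub_mem_vectorSpan ho hz), inv_mul_le_one₀ h0, map_sub]
    linarith [hlu z hz]
  have h1 := h _ hmem
  rw [real_inner_smul_left, hal _ hx, inv_mul_le_one₀ h0, map_sub] at h1
  linarith

/-- A proper face misses the relative interior point o, so its supporting functional has a positive
gap there and can be normalised to level 1. -/
theorem exists_polarAt_face_eq (ho : o ∈ intrinsicInterior ℝ D) {F : Set E}
    (hF : IsExposed ℝ D F) (hne : F.Nonempty) (hFD : F ≠ D) :
    ∃ y ∈ polarAt D o, F = {x ∈ D | inner ℝ y (x - o) = 1} := by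
  obtain ⟨l, c, hlc, rfl⟩ := hF.exists_eq_setOf hne
  obtain ⟨a, ha, hal⟩ := exists_mem_inner_eq (vectorSpan ℝ D) l
  have hoD := intrinsicInterior_subset ho
  have h0 : 0 < c - l o := by
    rw [sub_pos]
    refine (hlc o hoD).lt_of_ne fun heq => hFD ?_
    refine Subset.antisymm (fun x hx => hx.1) fun x hx => ⟨hx, ?_⟩
    obtain ⟨ε, hε, hmem⟩ := exists_pos_add_smul_mem ho
      (Submodule.neg_mem _ (sub_mem_vectorSpan ho hx))
    have h1 := hlc _ hmem
    rw [map_add, map_smul, map_neg, map_sub, smul_eq_mul] at h1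
    have h2 := hlc x hx
    by_contra hne'
    have h3 : l x < c := h2.lt_of_ne hne'
    nlinarith
  refine ⟨(c - l o)⁻¹ • a, ⟨Submodule.smul_mem _ _ ha, fun z hz => ?_⟩, ?_⟩
  · rw [real_inner_smul_left, hal _ (sub_mem_vectorSpan ho hz), inv_mul_le_one₀ h0, map_sub]
    linarith [hlc z hz]
  · ext x
    refine and_congr_right fun hx => ?_
    rw [real_inner_smul_left, hal _ (sub_mem_vectorSpan ho hx), inv_mul_eq_one₀ h0.ne', map_sub]
    constructor <;> intro h <;> linarith

theorem exists_face_polarAt_eq (hD : IsFiniteHull D) (ho : o ∈ intrinsicInterior ℝ D) {G : Set E}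
    (hG : IsExposed ℝ (polarAt D o) G) (hne : G.Nonempty) (hGD : G ≠ polarAt D o) :
    ∃ x ∈ D, G = {y ∈ polarAt D o | inner ℝ y (x - o) = 1} := by
  obtain ⟨l, c, hlc, rfl⟩ := hG.exists_eq_setOf hne
  obtain ⟨a, ha, hal⟩ := exists_mem_inner_eq (vectorSpan ℝ D) l
  have hc : 0 < c := by
    have h0 := hlc 0 zero_mem_polarAt
    rw [map_zero] at h0
    refine h0.lt_of_ne fun heq => hGD ?_
    subst heq
    refine Subset.antisymm (fun x hx => hx.1) fun y hy => ⟨hy, ?_⟩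
    obtain ⟨ε, hε, hmem⟩ := exists_pos_smul_mem_polarAt (o := o) hD (Submodule.neg_mem _ hy.1)
    have h1 := hlc _ hmem
    rw [map_smul, map_neg, smul_eq_mul] at h1
    have h2 := hlc y hy
    by_contra hne'
    have h3 : l y < 0 := h2.lt_of_ne hne'
    nlinarith
  have hin : ∀ y ∈ polarAt D o, inner ℝ y (o + c⁻¹ • a - o) = c⁻¹ * l y := fun y hy => by
    rw [add_sub_cancel_left, real_inner_smul_right, real_inner_comm, hal y hy.1]
  refine ⟨o + c⁻¹ • a, mem_of_forall_polarAt hD ho ?_ fun y hy => ?_, ?_⟩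
  · rw [add_sub_cancel_left]
    exact Submodule.smul_mem _ _ ha
  · rw [hin y hy, inv_mul_le_one₀ hc]
    exact hlc y hy
  · ext y
    refine and_congr_right fun hy => ?_
    rw [hin y hy, inv_mul_eq_one₀ hc.ne']
    exact eq_comm

/-- The face of the polar that is dual to a face of `D`. -/
def polarFace (D : Set E) (o : E) (A : Set E) : Set E :=
  {y ∈ polarAt D o | ∀ x ∈ A, inner ℝ y (x - o) = 1}

/-- The face of `D` that is dual to a face of the polar. -/
def prepolarFace (D : Set E) (o : E) (B : Set E) : Set E :=
  {x ∈ D | ∀ y ∈ B, inner ℝ y (x - o) = 1}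

omit [FiniteDimensional ℝ E] in
-- The conditions for all points of F reduce to those for its finitely many vertices, and a finite
-- intersection of faces is a face.
theorem isExposed_polarFace (hD : IsFiniteHull D) {F : Set E} (hF : IsExposed ℝ D F) :
    IsExposed ℝ (polarAt D o) (polarFace D o F) := by
  have hfin : (D.exposedPoints ℝ ∩ F).Finite := hD.finite_exposedPoints.subset inter_subset_left
  have key : IsExposed ℝ (polarAt D o) {y ∈ polarAt D o |
      ∀ x ∈ D.exposedPoints ℝ ∩ F, innerSL ℝ (x - o) y = 1} := by
    refine isExposed_setOf_forall_eq hfin (fun x => innerSL ℝ (x - o)) (fun _ => 1) ?_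
    intro x hx y hy
    rw [innerSL_apply_apply, real_inner_comm]
    exact hy.2 x hx.1.1
  suffices h : polarFace D o F = {y ∈ polarAt D o |
      ∀ x ∈ D.exposedPoints ℝ ∩ F, innerSL ℝ (x - o) y = 1} by rwa [h]
  · ext y
    refine and_congr_right fun hy => ⟨fun h x hx => ?_, fun h x hx => ?_⟩
    · rw [innerSL_apply_apply, real_inner_comm]
      exact h x hx.2
    · rw [← hD.convexHull_face hF] at hx
      have := eq_of_mem_convexHull (innerSL ℝ y) hx (c := 1 + inner ℝ y o) fun z hz => by
        have := h z hz
        rw [innerSL_apply_apply, real_inner_comm, inner_sub_right] at this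
        rw [innerSL_apply_apply]
        linarith
      rw [innerSL_apply_apply] at this
      rw [inner_sub_right, this]
      ring

theorem isExposed_prepolarFace (hD : IsFiniteHull D) (ho : o ∈ intrinsicInterior ℝ D) {G : Set E}
    (hG : IsExposed ℝ (polarAt D o) G) : IsExposed ℝ D (prepolarFace D o G) := by
  have hP := isFiniteHull_polarAt hD ho
  have hfin : ((polarAt D o).exposedPoints ℝ ∩ G).Finite :=
    hP.finite_exposedPoints.subset inter_subset_left
  have key : IsExposed ℝ D {x ∈ D |
      ∀ y ∈ (polarAt D o).exposedPoints ℝ ∩ G, innerSL ℝ y x = 1 + inner ℝ y o} := by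
    refine isExposed_setOf_forall_eq hfin (fun y => innerSL ℝ y) (fun y => 1 + inner ℝ y o) ?_
    intro y hy x hx
    have := hy.1.1.2 x hx
    rw [inner_sub_right] at this
    rw [innerSL_apply_apply]
    linarith
  suffices h : prepolarFace D o G = {x ∈ D |
      ∀ y ∈ (polarAt D o).exposedPoints ℝ ∩ G, innerSL ℝ y x = 1 + inner ℝ y o} by rwa [h]
  · ext x
    refine and_congr_right fun hx => ⟨fun h y hy => ?_, fun h y hy => ?_⟩
    · have := h y hy.2
      rw [inner_sub_right] at this
      rw [innerSL_apply_apply]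
      linarith
    · rw [← hP.convexHull_face hG] at hy
      have := eq_of_mem_convexHull (innerSL ℝ (x - o)) hy (c := 1) fun z hz => by
        have := h z hz
        rw [innerSL_apply_apply] at this
        rw [innerSL_apply_apply, real_inner_comm, inner_sub_right, this]
        ring
      rwa [innerSL_apply_apply, real_inner_comm] at this

omit [FiniteDimensional ℝ E] in
theorem prepolarFace_eq_empty {B : Set E} (h : (0 : E) ∈ B) : prepolarFace D o B = ∅ := by
  refine eq_empty_of_forall_notMem fun x hx => ?_
  have := hx.2 0 h
  rw [inner_zero_left] at this
  exact zero_ne_one this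

omit [FiniteDimensional ℝ E] in
theorem polarFace_eq_empty {A : Set E} (h : o ∈ A) : polarFace D o A = ∅ := by
  refine eq_empty_of_forall_notMem fun x hx => ?_
  have := hx.2 o h
  rw [sub_self, inner_zero_right] at this
  exact zero_ne_one this

/-- A nonempty proper face is cut out by a single polar vector, which lies in the dual face. The
faces ∅ and D are exchanged with the extremes of the polar because 0 and o satisfy no equation
`inner ℝ y (x - o) = 1`. -/
theorem prepolarFace_polarFace (ho : o ∈ intrinsicInterior ℝ D) {F : Set E}
    (hF : IsExposed ℝ D F) : prepolarFace D o (polarFace D o F) = F := by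
  rcases F.eq_empty_or_nonempty with rfl | hne
  · exact prepolarFace_eq_empty ⟨zero_mem_polarAt, fun x hx => absurd hx (notMem_empty x)⟩
  by_cases hFD : F = D
  · subst hFD
    rw [polarFace_eq_empty (intrinsicInterior_subset ho)]
    simp [prepolarFace]
  obtain ⟨y, hy, hFy⟩ := exists_polarAt_face_eq ho hF hne hFD
  refine Subset.antisymm (fun x hx => ?_) fun x hx => ⟨hF.subset hx, fun z hz => hz.2 x hx⟩
  rw [hFy]
  exact ⟨hx.1, hx.2 y ⟨hy, fun z hz => (hFy ▸ hz : z ∈ {x ∈ D | inner ℝ y (x - o) = 1}).2⟩⟩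

theorem polarFace_prepolarFace (hD : IsFiniteHull D) (ho : o ∈ intrinsicInterior ℝ D) {G : Set E}
    (hG : IsExposed ℝ (polarAt D o) G) : polarFace D o (prepolarFace D o G) = G := by
  rcases G.eq_empty_or_nonempty with rfl | hne
  · exact polarFace_eq_empty ⟨intrinsicInterior_subset ho, fun x hx => absurd hx (notMem_empty x)⟩
  by_cases hGD : G = polarAt D o
  · subst hGD
    rw [prepolarFace_eq_empty zero_mem_polarAt]
    simp [polarFace]
  obtain ⟨x, hx, hGx⟩ := exists_face_polarAt_eq hD ho hG hne hGD
  refine Subset.antisymm (fun y hy => ?_) fun y hy => ⟨hG.subset hy, fun z hz => hz.2 y hy⟩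
  rw [hGx]
  exact ⟨hy.1, hy.2 x ⟨hx, fun z hz =>
    (hGx ▸ hz : z ∈ {y ∈ polarAt D o | inner ℝ y (x - o) = 1}).2⟩⟩

/-- The face lattice of the polar is dual to the face lattice of the polytope. -/
def polarFaceIso (hD : IsFiniteHull D) (ho : o ∈ intrinsicInterior ℝ D) :
    (FaceLattice D)ᵒᵈ ≃o FaceLattice (polarAt D o) where
  toFun F := ⟨polarFace D o (OrderDual.ofDual F).1, isExposed_polarFace hD (OrderDual.ofDual F).2⟩
  invFun G := OrderDual.toDual ⟨prepolarFace D o G.1, isExposed_prepolarFace hD ho G.2⟩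
  left_inv F := OrderDual.ofDual.injective (Subtype.ext
    (prepolarFace_polarFace ho (OrderDual.ofDual F).2))
  right_inv G := Subtype.ext (polarFace_prepolarFace hD ho G.2)
  map_rel_iff' := by
    intro F F'
    constructor
    · intro h
      have h' : polarFace D o (OrderDual.ofDual F).1 ⊆ polarFace D o (OrderDual.ofDual F').1 := h
      change (OrderDual.ofDual F').1 ⊆ (OrderDual.ofDual F).1
      rw [← prepolarFace_polarFace ho (OrderDual.ofDual F).2,
        ← prepolarFace_polarFace ho (OrderDual.ofDual F').2]
      exact fun x hx => ⟨hx.1, fun y hy => hx.2 y (h' hy)⟩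
    · intro h
      have h' : (OrderDual.ofDual F').1 ⊆ (OrderDual.ofDual F).1 := h
      exact fun y hy => ⟨hy.1, fun x hx => hy.2 x (h' hx)⟩

end PolarDuality

/-! ### Vertex truncations: edge points, faces and dimension. -/

section Truncation

variable {E : Type*} [NormedAddCommGroup E] [InnerProductSpace ℝ E] {P D : Set E}

/-- A vertex truncation given by explicit linear inequalities `l v ≤ c v`, where `v` runs through
the vertices. -/
structure IsTruncationBy (P D : Set E) (l : E → StrongDual ℝ E) (c : E → ℝ) : Prop where
  lt_self : ∀ v ∈ P.exposedPoints ℝ, c v < l v v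
  lt_of_ne : ∀ v ∈ P.exposedPoints ℝ, ∀ w ∈ P.exposedPoints ℝ, w ≠ v → l v w < c v
  mem_iff : ∀ x, x ∈ D ↔ x ∈ P ∧ ∀ v ∈ P.exposedPoints ℝ, l v x ≤ c v
  edge : ∀ e, IsEdgeOf P e → ∃ u, e ∩ D = {u}

theorem IsVertexTruncation.exists_isTruncationBy (h : IsVertexTruncation P D) :
    ∃ l c, IsTruncationBy P D l c := by
  obtain ⟨H, hH, hD, he⟩ := h
  have h1 : ∀ v, ∃ (l : StrongDual ℝ E) (c : ℝ), v ∈ P.exposedPoints ℝ →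
      l ≠ 0 ∧ H v = {x | l x ≤ c} := by
    intro v
    by_cases hv : v ∈ P.exposedPoints ℝ
    · obtain ⟨l, c, h⟩ := (hH v hv).1
      exact ⟨l, c, fun _ => h⟩
    · exact ⟨0, 0, fun h => absurd h hv⟩
  choose l c hlc using h1
  refine ⟨l, c, fun v hv => ?_, fun v hv w hw hne => ?_, fun x => ?_, fun e hedge => ?_⟩
  · have := (hH v hv).2.1
    rw [(hlc v hv).2] at this
    exact not_le.1 this
  · have := (hH v hv).2.2 w hw hne
    rw [(hlc v hv).2] at this
    have heq : {x | l v x ≤ c v} = l v ⁻¹' Iic (c v) := rfl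
    -- A nonzero functional is open, so interior points of the half-space satisfy the strict
    -- inequality.
    rw [heq, ← ((l v).isOpenMap_of_ne_zero (hlc v hv).1).preimage_interior_eq_interior_preimage
      (l v).continuous, interior_Iic] at this
    exact this
  · rw [hD, mem_inter_iff, mem_iInter₂]
    refine and_congr_right fun _ => forall₂_congr fun v hv => ?_
    rw [(hlc v hv).2]
    rfl
  · obtain ⟨u, -, hu⟩ := he e hedge
    exact ⟨u, hu⟩

/-- The points in which the edges at `v` meet the truncated polytope. -/
def edgePointsAt (P D : Set E) (v : E) : Set E := {u | ∃ e, IsEdgeOf P e ∧ v ∈ e ∧ u ∈ e ∩ D}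

/-- The points in which the edges meet the truncated polytope. -/
def edgePoints (P D : Set E) : Set E := {u | ∃ e, IsEdgeOf P e ∧ u ∈ e ∩ D}

namespace IsTruncationBy

variable {l : E → StrongDual ℝ E} {c : E → ℝ}

theorem subset (T : IsTruncationBy P D l c) : D ⊆ P := fun x hx => ((T.mem_iff x).1 hx).1

theorem convex (T : IsTruncationBy P D l c) (hP : IsFiniteHull P) : Convex ℝ D := by
  have : D = P ∩ ⋂ v ∈ P.exposedPoints ℝ, {x | l v x ≤ c v} := by
    ext x
    simp [T.mem_iff]
  rw [this]
  exact hP.convex.inter (convex_iInter₂ fun v _ =>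
    convex_halfSpace_le (l v).toLinearMap.isLinear (c v))

theorem isCompact (T : IsTruncationBy P D l c) (hP : IsFiniteHull P) : IsCompact D := by
  have : D = P ∩ ⋂ v ∈ P.exposedPoints ℝ, {x | l v x ≤ c v} := by
    ext x
    simp [T.mem_iff]
  rw [this]
  exact hP.isCompact.inter_right (isClosed_biInter fun v _ =>
    isClosed_le (l v).continuous continuous_const)

theorem notMem_of_exposedPoint (T : IsTruncationBy P D l c) {v : E}
    (hv : v ∈ P.exposedPoints ℝ) : v ∉ D := fun h =>
  (T.lt_self v hv).not_ge (((T.mem_iff v).1 h).2 v hv)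

theorem eq_of_mem_edge (T : IsTruncationBy P D l c) {e : Set E} (he : IsEdgeOf P e) {u u' : E}
    (hu : u ∈ e ∩ D) (hu' : u' ∈ e ∩ D) : u = u' := by
  obtain ⟨a, ha⟩ := T.edge e he
  rw [ha] at hu hu'
  exact hu.trans hu'.symm

theorem nonempty_edge_inter (T : IsTruncationBy P D l c) {e : Set E} (he : IsEdgeOf P e) :
    (e ∩ D).Nonempty := by
  obtain ⟨a, ha⟩ := T.edge e he
  exact ⟨a, by rw [ha]; exact mem_singleton a⟩

/-- If the cut at v were slack at u, one could slide from u towards v inside D, giving the edge a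
second point of D. -/
theorem apply_eq_of_mem (T : IsTruncationBy P D l c) (hP : IsFiniteHull P) {e : Set E}
    (he : IsEdgeOf P e) {u v : E} (hu : u ∈ e ∩ D) (hv : v ∈ P.exposedPoints ℝ) (hve : v ∈ e) :
    l v u = c v := by
  have hu2 := (T.mem_iff u).1 hu.2
  refine (hu2.2 v hv).eq_or_lt.resolve_right fun hlt => ?_
  have h0 : 0 < l v v - l v u := by linarith [T.lt_self v hv]
  -- The parameter at which the inequality at v becomes an equality.
  set t := (c v - l v u) / (l v v - l v u) with ht
  have ht0 : 0 < t := div_pos (by linarith) h0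
  have ht1 : t ≤ 1 := by
    rw [ht, div_le_one h0]
    linarith [T.lt_self v hv]
  have hmem : (1 - t) • u + t • v ∈ e :=
    he.1.convex hP.convex hu.1 hve (by linarith) ht0.le (by ring)
  have hmemD : (1 - t) • u + t • v ∈ D := by
    refine (T.mem_iff _).2 ⟨he.1.subset hmem, fun w hw => ?_⟩
    simp only [map_add, map_smul, smul_eq_mul]
    rcases eq_or_ne w v with rfl | hne
    · have : t * (l w w - l w u) = c w - l w u := div_mul_cancel₀ _ h0.ne'
      linarith
    · have h1 := T.lt_of_ne w hw v hv hne.symm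
      have h2 := hu2.2 w hw
      nlinarith
  have heq := T.eq_of_mem_edge he hu ⟨hmem, hmemD⟩
  have h1 : t • (v - u) = 0 := by
    have : t • (v - u) = ((1 - t) • u + t • v) - u := by module
    rw [this, ← heq, sub_self]
  rcases smul_eq_zero.1 h1 with h | h
  · exact ht0.ne' h
  · rw [sub_eq_zero.1 h, sub_self] at h0
    exact lt_irrefl _ h0

theorem apply_eq_iff_mem (T : IsTruncationBy P D l c) (hP : IsFiniteHull P) {e : Set E}
    (he : IsEdgeOf P e) {u v : E} (hu : u ∈ e ∩ D) (hv : v ∈ P.exposedPoints ℝ) :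
    l v u = c v ↔ v ∈ e := by
  refine ⟨fun h => ?_, T.apply_eq_of_mem hP he hu hv⟩
  by_contra hve
  obtain ⟨a, ha, b, hb, -, rfl⟩ := he.exists_segment hP
  have hlt : segment ℝ a b ⊆ {x | l v x < c v} :=
    (convex_halfSpace_lt (l v).toLinearMap.isLinear (c v)).segment_subset
      (T.lt_of_ne v hv a ha fun h' => hve (h' ▸ left_mem_segment ℝ a b))
      (T.lt_of_ne v hv b hb fun h' => hve (h' ▸ right_mem_segment ℝ a b))
  exact (hlt hu.1).ne h

/-- Vertices are cut off, so u is interior to its edge, and a face containing it contains both ends.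
-/
theorem subset_of_mem (T : IsTruncationBy P D l c) (hP : IsFiniteHull P) {e G : Set E}
    (he : IsEdgeOf P e) (hG : IsExposed ℝ P G) {u : E} (hu : u ∈ e ∩ D) (huG : u ∈ G) :
    e ⊆ G := by
  obtain ⟨a, ha, b, hb, -, rfl⟩ := he.exists_segment hP
  have hopen : u ∈ openSegment ℝ a b := mem_openSegment_of_ne_left_right
    (fun h => T.notMem_of_exposedPoint ha (h ▸ hu.2))
    (fun h => T.notMem_of_exposedPoint hb (h ▸ hu.2)) hu.1
  exact (hG.convex hP.convex).segment_subset
    (hG.isExtreme.left_mem_of_mem_openSegment ha.1 hb.1 huG hopen)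
    (hG.isExtreme.right_mem_of_mem_openSegment ha.1 hb.1 huG hopen)

theorem sub_mem_span (T : IsTruncationBy P D l c) (hP : IsFiniteHull P) {v x : E}
    (hv : v ∈ P.exposedPoints ℝ) (hx : x ∈ P) :
    x - v ∈ Submodule.span ℝ≥0 ((fun u => u - v) '' edgePointsAt P D v) := by
  refine (Submodule.span_le.2 ?_) (hP.sub_mem_span_edgeDirections hv hx)
  rintro _ ⟨w, hw, hwv, hwe, rfl⟩
  have he := isEdgeOf_segment hwv.symm hwe
  obtain ⟨u, hu⟩ := T.nonempty_edge_inter he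
  obtain ⟨a, b, ha, hb, hab, rfl⟩ := id hu.1
  have hb0 : b ≠ 0 := by
    rintro rfl
    have : a = 1 := by linarith
    subst this
    rw [one_smul, zero_smul, add_zero] at hu
    exact T.notMem_of_exposedPoint hv hu.2
  have h1 : w - v = b⁻¹ • ((a • v + b • w) - v) := by
    have : a • v + b • w - v = b • (w - v) := by
      have : a = 1 - b := by linarith
      subst this
      module
    rw [this, smul_smul, inv_mul_cancel₀ hb0, one_smul]
  rw [h1]
  exact smul_mem_of_nonneg _ (inv_nonneg.2 hb)
    (Submodule.subset_span ⟨_, ⟨_, he, left_mem_segment ℝ v w, hu⟩, rfl⟩)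

/-- The cut at v is a section of the cone at v: `l v` takes the same negative value on all
generators u - v and on x - v, so the scaling factor of x - v is 1. -/
theorem mem_convexHull_edgePointsAt (T : IsTruncationBy P D l c) (hP : IsFiniteHull P) {v x : E}
    (hv : v ∈ P.exposedPoints ℝ) (hx : x ∈ P) (hlx : l v x = c v) :
    x ∈ convexHull ℝ (edgePointsAt P D v) := by
  have hlt := T.lt_self v hv
  rcases exists_smul_mem_convexHull (T.sub_mem_span hP hv hx) with h | ⟨t, ht, k, hk, h⟩
  · rw [sub_eq_zero.1 h] at hlx
    exact absurd hlx hlt.ne'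
  have hlk : l v k = c v - l v v := by
    refine eq_of_mem_convexHull (l v) hk ?_
    rintro _ ⟨u, ⟨e, he, hve, hu⟩, rfl⟩
    rw [map_sub, T.apply_eq_of_mem hP he hu hv hve]
  have ht1 : t = 1 := by
    have := congrArg (l v) h
    rw [map_sub, map_smul, smul_eq_mul, hlk, hlx] at this
    have h0 : c v - l v v ≠ 0 := by linarith
    exact (mul_right_cancel₀ h0 (by rw [one_mul]; exact this)).symm
  have hsub : convexHull ℝ ((fun u => u - v) '' edgePointsAt P D v) ⊆
      (fun z => v + z) ⁻¹' convexHull ℝ (edgePointsAt P D v) := by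
    refine convexHull_min ?_ ((convex_convexHull ℝ _).translate_preimage_right v)
    rintro _ ⟨u, hu, rfl⟩
    rw [mem_preimage, add_sub_cancel]
    exact subset_convexHull ℝ _ hu
  have := hsub hk
  rw [ht1, one_smul] at h
  rw [← h, mem_preimage, add_sub_cancel] at this
  exact this

theorem eventually_add_smul_mem (T : IsTruncationBy P D l c) (hP : IsFiniteHull P) {x p : E}
    (hx : x ∈ P) (hlx : ∀ v ∈ P.exposedPoints ℝ, l v x < c v) (hp : p ∈ P) :
    ∀ᶠ ε in 𝓝[>] (0 : ℝ), x + ε • (p - x) ∈ D := by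
  have h1 : ∀ᶠ ε in 𝓝[>] (0 : ℝ), ∀ v ∈ P.exposedPoints ℝ, l v (x + ε • (p - x)) < c v := by
    rw [Filter.eventually_all_finite hP.finite_exposedPoints]
    intro v hv
    refine eventually_nhdsWithin_of_eventually_nhds ?_
    have hc : Continuous fun ε : ℝ => l v (x + ε • (p - x)) := by fun_prop
    exact (hc.tendsto 0).eventually_lt_const (by simpa using hlx v hv)
  have h2 : ∀ᶠ ε in 𝓝[>] (0 : ℝ), ε < 1 :=
    eventually_nhdsWithin_of_eventually_nhds (eventually_lt_nhds one_pos)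
  filter_upwards [h1, h2, self_mem_nhdsWithin] with ε hε1 hε2 hε3
  refine (T.mem_iff _).2 ⟨?_, fun v hv => (hε1 v hv).le⟩
  exact hP.convex.add_smul_sub_mem hx hp ⟨(le_of_lt hε3), hε2.le⟩

theorem edgePointsAt_subset {v : E} : edgePointsAt P D v ⊆ D := by
  rintro u ⟨e, -, -, hu⟩
  exact hu.2

/-- On a cut, x lies in the hull of edge points contained in D, so by extremality it is one of them.
Off all cuts, D agrees with P along short segments, so x would be a vertex of P, which is cut off.
-/
theorem extremePoints_subset (T : IsTruncationBy P D l c) (hP : IsFiniteHull P) :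
    D.extremePoints ℝ ⊆ edgePoints P D := by
  intro x hx
  have hxD := (T.mem_iff x).1 hx.1
  by_cases h : ∃ v ∈ P.exposedPoints ℝ, l v x = c v
  · obtain ⟨v, hv, hlx⟩ := h
    have hxc := T.mem_convexHull_edgePointsAt hP hv hxD.1 hlx
    have hsub : convexHull ℝ (edgePointsAt P D v) ⊆ D :=
      convexHull_min edgePointsAt_subset (T.convex hP)
    obtain ⟨e, he, -, hu⟩ := extremePoints_convexHull_subset
      (inter_extremePoints_subset_extremePoints_of_subset hsub ⟨hxc, hx⟩)
    exact ⟨e, he, hu⟩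
  · push Not at h
    have hlt : ∀ v ∈ P.exposedPoints ℝ, l v x < c v := fun v hv =>
      (hxD.2 v hv).lt_of_ne (h v hv)
    have hxP : x ∈ P.extremePoints ℝ := by
      refine mem_extremePoints_iff_left.2 ⟨hxD.1, fun a ha b hb hab => ?_⟩
      obtain ⟨ε, ⟨h1, h2⟩, h3⟩ := (((T.eventually_add_smul_mem hP hxD.1 hlt ha).and
        (T.eventually_add_smul_mem hP hxD.1 hlt hb)).and self_mem_nhdsWithin).exists
      have hmem : x ∈ openSegment ℝ (x + ε • (a - x)) (x + ε • (b - x)) := by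
        obtain ⟨s, t, hs, ht, hst, hx'⟩ := hab
        refine ⟨s, t, hs, ht, hst, ?_⟩
        have : s • (x + ε • (a - x)) + t • (x + ε • (b - x)) =
            ((s + t) - ε * (s + t)) • x + ε • (s • a + t • b) := by module
        rw [this, hx', hst]
        module
      have h4 := ((mem_extremePoints.1 hx).2 _ h1 _ h2 hmem).1
      rw [add_eq_left, smul_eq_zero] at h4
      rcases h4 with h4 | h4
      · exact absurd h4 (ne_of_gt h3)
      · exact sub_eq_zero.1 h4
    rw [hP.extremePoints_eq] at hxP
    exact absurd hx.1 (T.notMem_of_exposedPoint hxP)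

theorem finite_edgePoints (T : IsTruncationBy P D l c) (hP : IsFiniteHull P) :
    (edgePoints P D).Finite := by
  have hV := hP.finite_exposedPoints
  refine (hV.biUnion fun v _ => hV.biUnion fun w _ =>
    (?_ : {u ∈ segment ℝ v w ∩ D | IsEdgeOf P (segment ℝ v w)}.Finite)).subset ?_
  · exact Set.Subsingleton.finite fun u hu u' hu' => T.eq_of_mem_edge hu.2 hu.1 hu'.1
  · rintro u ⟨e, he, hu⟩
    obtain ⟨v, hv, w, hw, -, rfl⟩ := he.exists_segment hP
    exact mem_iUnion₂.2 ⟨v, hv, mem_iUnion₂.2 ⟨w, hw, hu, he⟩⟩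

theorem isFiniteHull (T : IsTruncationBy P D l c) (hP : IsFiniteHull P) : IsFiniteHull D := by
  have hfin := (T.finite_edgePoints hP).subset (T.extremePoints_subset hP)
  exact ⟨_, hfin, ((T.isCompact hP).convexHull_extremePoints_eq (T.convex hP) hfin).symm⟩

theorem face_subset_convexHull (T : IsTruncationBy P D l c) (hP : IsFiniteHull P) {F : Set E}
    (hF : IsExposed ℝ D F) : F ⊆ convexHull ℝ (edgePoints P D ∩ F) := by
  conv_lhs => rw [← (T.isFiniteHull hP).convexHull_face hF]
  exact convexHull_mono (inter_subset_inter_left F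
    (exposedPoints_subset_extremePoints.trans (T.extremePoints_subset hP)))

/-- A face of a vertex truncation is recorded by the edges of the polytope that it meets. -/
def edgeEmbedding (T : IsTruncationBy P D l c) (hP : IsFiniteHull P) :
    FaceLattice D ↪o Set (FaceLattice P) :=
  OrderEmbedding.ofMapLEIff (fun F => {y | IsEdgeOf P y.1 ∧ (y.1 ∩ F.1).Nonempty}) <| by
    intro F F'
    refine ⟨fun h => ?_, fun h y hy => ⟨hy.1, hy.2.mono (inter_subset_inter_right _ h)⟩⟩
    refine (T.face_subset_convexHull hP F.2).trans
      (convexHull_min ?_ (F'.2.convex (T.convex hP)))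
    rintro u ⟨⟨e, he, hu⟩, huF⟩
    obtain ⟨-, u', hu'e, hu'F⟩ :=
      h (show (⟨e, he.1⟩ : FaceLattice P) ∈ _ from ⟨he, u, hu.1, huF⟩)
    rwa [T.eq_of_mem_edge he hu ⟨hu'e, F'.2.subset hu'F⟩]

theorem _root_.IsExposed.inter_of_subset {G : Set E} (hG : IsExposed ℝ P G) (h : D ⊆ P) :
    IsExposed ℝ D (D ∩ G) := by
  rcases G.eq_empty_or_nonempty with rfl | hne
  · rw [inter_empty]
    exact isExposed_empty
  obtain ⟨m, k, hmk, rfl⟩ := hG.exists_eq_setOf hne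
  have : D ∩ {x ∈ P | m x = k} = {x ∈ D | m x = k} := by
    ext x
    exact ⟨fun hx => ⟨hx.1, hx.2.2⟩, fun hx => ⟨hx.1, h hx.1, hx.2⟩⟩
  rw [this]
  exact isExposed_setOf_eq m fun y hy => hmk y (h hy)

theorem exists_face_of_isEtElement (T : IsTruncationBy P D l c) (hP : IsFiniteHull P)
    {S : Set (FaceLattice P)} (hS : IsEtElement 1 S) :
    ∃ F : FaceLattice D, T.edgeEmbedding hP F = edgesIn S := by
  have hface : ∀ G : FaceLattice P, ∀ e : FaceLattice P, IsEdgeOf P e.1 →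
      ((e.1 ∩ (D ∩ G.1)).Nonempty ↔ e ≤ G) := by
    intro G e he
    constructor
    · rintro ⟨u, hue, huD, huG⟩
      exact T.subset_of_mem hP he G.2 ⟨hue, huD⟩ huG
    · intro h
      obtain ⟨u, hu⟩ := T.nonempty_edge_inter he
      exact ⟨u, hu.1, hu.2, h hu.1⟩
  rcases hS with rfl | ⟨y, hy, rfl⟩ | ⟨x, z, rfl, y, hy, hxy, hyz⟩
  · refine ⟨⟨∅, isExposed_empty⟩, ?_⟩
    ext e
    refine ⟨fun h => ?_, fun h => absurd h.1 (notMem_empty e)⟩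
    obtain ⟨-, u, -, hu⟩ := h
    exact absurd hu (notMem_empty u)
  · rw [height_eq_two_iff hP] at hy
    refine ⟨⟨D ∩ y.1, y.2.inter_of_subset T.subset⟩, ?_⟩
    ext e
    constructor
    · rintro ⟨he, h⟩
      exact ⟨Subtype.ext (he.eq_of_subset hP hy ((hface y e he).1 h)), he⟩
    · rintro ⟨rfl, he⟩
      exact ⟨he, (hface e e he).2 le_rfl⟩
  · rw [height_eq_two_iff hP] at hy
    obtain ⟨v, hv, hvy, hxv⟩ := hy.exists_exposedPoint_of_ssubset hP x.2 hxy
    rcases subset_singleton_iff_eq.1 hxv with h0 | h0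
    · refine ⟨⟨D ∩ z.1, z.2.inter_of_subset T.subset⟩, ?_⟩
      ext e
      constructor
      · rintro ⟨he, h⟩
        refine ⟨⟨?_, (hface z e he).1 h⟩, he⟩
        change x.1 ⊆ e.1
        rw [h0]
        exact empty_subset _
      · rintro ⟨h, he⟩
        exact ⟨he, (hface z e he).2 h.2⟩
    · have hexp : IsExposed ℝ D {x ∈ D | l v x = c v} :=
        isExposed_setOf_eq (l v) fun y hy => ((T.mem_iff y).1 hy).2 v hv
      refine ⟨⟨_, (z.2.inter_of_subset T.subset).inter hexp⟩, ?_⟩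
      ext e
      constructor
      · rintro ⟨he, u, hue, ⟨huD, huz⟩, -, hlu⟩
        refine ⟨⟨?_, (hface z e he).1 ⟨u, hue, huD, huz⟩⟩, he⟩
        change x.1 ⊆ e.1
        rw [h0, singleton_subset_iff]
        exact (T.apply_eq_iff_mem hP he ⟨hue, huD⟩ hv).1 hlu
      · rintro ⟨⟨h1, h2⟩, he⟩
        obtain ⟨u, hu⟩ := T.nonempty_edge_inter he
        have hve : v ∈ e.1 := h1 (by rw [h0]; exact mem_singleton v)
        exact ⟨he, u, hu.1, ⟨hu.2, h2 hu.1⟩, hu.2, T.apply_eq_of_mem hP he hu hv hve⟩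

theorem exists_mem_forall_lt {ι : Type*} {s : Set ι} (hs : s.Finite) {F : Set E}
    (hF : Convex ℝ F) (hne : F.Nonempty) (m : ι → StrongDual ℝ E) (k : ι → ℝ)
    (hle : ∀ i ∈ s, ∀ x ∈ F, m i x ≤ k i) (hlt : ∀ i ∈ s, ∃ x ∈ F, m i x < k i) :
    ∃ x ∈ F, ∀ i ∈ s, m i x < k i := by
  induction s, hs using Set.Finite.induction_on with
  | empty => exact ⟨hne.some, hne.some_mem, fun i hi => absurd hi (notMem_empty i)⟩
  | @insert a s _ _ ih =>
    obtain ⟨x, hx, hxs⟩ := ih (fun i hi => hle i (mem_insert_of_mem a hi))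
      fun i hi => hlt i (mem_insert_of_mem a hi)
    obtain ⟨y, hy, hya⟩ := hlt a (mem_insert a s)
    refine ⟨(1 / 2 : ℝ) • x + (1 / 2 : ℝ) • y,
      hF hx hy (by norm_num) (by norm_num) (by norm_num), fun i hi => ?_⟩
    simp only [map_add, map_smul, smul_eq_mul]
    rcases mem_insert_iff.1 hi with rfl | hi'
    · linarith [hle i (mem_insert i s) x hx]
    · linarith [hle i hi y hy, hxs i hi']

/-- With at most one edge met, F gives ∅ or a singleton. Otherwise the lower end of the interval
depends on whether some cut contains F, and the upper end is a face of P supported by the functional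
of F, tilted if necessary. -/
theorem exists_isEtElement_of_face (T : IsTruncationBy P D l c) (hP : IsFiniteHull P)
    (F : FaceLattice D) :
    ∃ S : Set (FaceLattice P), IsEtElement 1 S ∧ edgesIn S = T.edgeEmbedding hP F := by
  set A := T.edgeEmbedding hP F with hA
  have hmemA : ∀ e : FaceLattice P, e ∈ A ↔ IsEdgeOf P e.1 ∧ (e.1 ∩ F.1).Nonempty :=
    fun e => Iff.rfl
  rcases F.1.eq_empty_or_nonempty with hF0 | hne
  · refine ⟨∅, Or.inl rfl, ?_⟩
    ext e
    rw [hmemA, hF0]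
    simp [edgesIn]
  obtain ⟨y₁, hy₁⟩ : A.Nonempty := by
    have := hne.mono (T.face_subset_convexHull hP F.2)
    rw [convexHull_nonempty_iff] at this
    obtain ⟨u, ⟨e, he, hu⟩, huF⟩ := this
    exact ⟨⟨e, he.1⟩, he, u, hu.1, huF⟩
  by_cases hsub : A ⊆ {y₁}
  · refine ⟨{y₁}, Or.inr (Or.inl ⟨y₁, (height_eq_two_iff hP).2 hy₁.1, rfl⟩), ?_⟩
    ext e
    constructor
    · rintro ⟨rfl, -⟩
      exact hy₁
    · exact fun he => ⟨hsub he, he.1⟩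
  obtain ⟨y₂, hy₂, hne₂⟩ := not_subset.1 hsub
  -- Two distinct edges below z put y₁ strictly below z, as membership of an interval in E₁
  -- requires.
  have hlt : ∀ z : FaceLattice P, y₁ ≤ z → y₂ ≤ z → y₁ < z := fun z h1 h2 =>
    lt_of_le_not_ge h1 fun h => hne₂ (Subtype.ext (hy₂.1.eq_of_subset hP hy₁.1 (h2.trans h)))
  obtain ⟨m, k, hmk, hFeq⟩ := F.2.exists_eq_setOf hne
  by_cases hcase : ∃ v ∈ P.exposedPoints ℝ, ∀ x ∈ F.1, l v x = c v
  · obtain ⟨v, hv, hFv⟩ := hcase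
    have h0 : 0 < l v v - c v := sub_pos.2 (T.lt_self v hv)
    -- Chosen so that `m' v = k + t * c v`, the value of `m'` on F. On edge points at v the added
    -- term is constant, so `m' ≤ m' v` there whatever the sign of t, and hence on P by the cone
    -- property.
    set t := (k - m v) / (l v v - c v) with ht
    have htm : t * (l v v - c v) = k - m v := div_mul_cancel₀ _ h0.ne'
    set m' : StrongDual ℝ E := m + t • l v with hm'
    have hm'app : ∀ x, m' x = m x + t * l v x := fun x => rfl
    have hle : ∀ x ∈ P, m' x ≤ m' v := by
      intro x hx
      have := (map_nonpos_of_mem_span m' (T.sub_mem_span hP hv hx) ?_).1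
      · rw [map_sub] at this
        linarith
      · rintro _ ⟨u, ⟨e, he, hve, hu⟩, rfl⟩
        rw [map_sub, hm'app, hm'app, T.apply_eq_of_mem hP he hu hv hve]
        linarith [hmk u hu.2]
    let p : FaceLattice P := ⟨{v}, isExposed_singleton hv⟩
    let G : FaceLattice P := ⟨_, isExposed_setOf_eq m' hle⟩
    have hiff : ∀ e : FaceLattice P, e ∈ A ↔ (p ≤ e ∧ e ≤ G) ∧ IsEdgeOf P e.1 := by
      intro e
      rw [hmemA]
      constructor
      · rintro ⟨he, u, hue, huF⟩
        have huD := F.2.subset huF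
        have hve := (T.apply_eq_iff_mem hP he ⟨hue, huD⟩ hv).1 (hFv u huF)
        refine ⟨⟨singleton_subset_iff.2 hve, ?_⟩, he⟩
        refine T.subset_of_mem hP he G.2 ⟨hue, huD⟩ ⟨T.subset huD, ?_⟩
        rw [hFeq] at huF
        rw [hm'app, hm'app, T.apply_eq_of_mem hP he ⟨hue, huD⟩ hv hve, huF.2]
        linarith
      · rintro ⟨⟨h1, h2⟩, he⟩
        obtain ⟨u, hu⟩ := T.nonempty_edge_inter he
        have hve : v ∈ e.1 := singleton_subset_iff.1 h1
        refine ⟨he, u, hu.1, ?_⟩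
        have h3 : m' u = m' v := (h2 hu.1).2
        rw [hm'app, hm'app, T.apply_eq_of_mem hP he hu hv hve] at h3
        rw [hFeq]
        exact ⟨hu.2, by linarith⟩
    have h1 := (hiff y₁).1 hy₁
    have h2 := (hiff y₂).1 hy₂
    refine ⟨Icc p G, Or.inr (Or.inr ⟨p, G, rfl, y₁, (height_eq_two_iff hP).2 hy₁.1, ?_,
      hlt G h1.1.2 h2.1.2⟩), ?_⟩
    · refine lt_of_le_not_ge h1.1.1 fun h => ?_
      obtain ⟨a, -, b, -, hab, heq⟩ := hy₁.1.exists_segment hP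
      have ha : a = v := h (by rw [heq]; exact left_mem_segment ℝ a b)
      have hb : b = v := h (by rw [heq]; exact right_mem_segment ℝ a b)
      exact hab (ha.trans hb.symm)
    · ext e
      exact (hiff e).symm
  · push Not at hcase
    have hFD : ∀ x ∈ F.1, x ∈ D := fun x hx => F.2.subset hx
    -- Averaging points that are strict for the individual cuts gives a point of F strict for all;
    -- from it D contains a short segment towards each point of P.
    obtain ⟨x, hxF, hx⟩ := exists_mem_forall_lt hP.finite_exposedPoints
      (F.2.convex (T.convex hP)) hne l c (fun v hv x hx => ((T.mem_iff x).1 (hFD x hx)).2 v hv)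
      fun v hv => by
        obtain ⟨x, hx, hne⟩ := hcase v hv
        exact ⟨x, hx, (((T.mem_iff x).1 (hFD x hx)).2 v hv).lt_of_ne hne⟩
    have hmx : m x = k := by
      rw [hFeq] at hxF
      exact hxF.2
    have hle : ∀ p ∈ P, m p ≤ k := by
      intro p hp
      obtain ⟨ε, h1, h2⟩ := ((T.eventually_add_smul_mem hP (T.subset (hFD x hxF)) hx hp).and
        self_mem_nhdsWithin).exists
      have h3 := hmk _ h1
      have h4 : (0 : ℝ) < ε := h2
      rw [map_add, map_smul, map_sub, smul_eq_mul, hmx] at h3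
      by_contra! h5
      nlinarith
    let b : FaceLattice P := ⟨∅, isExposed_empty⟩
    let G : FaceLattice P := ⟨_, isExposed_setOf_eq m hle⟩
    have hiff : ∀ e : FaceLattice P, e ∈ A ↔ (b ≤ e ∧ e ≤ G) ∧ IsEdgeOf P e.1 := by
      intro e
      rw [hmemA]
      constructor
      · rintro ⟨he, u, hue, huF⟩
        have huD := F.2.subset huF
        refine ⟨⟨empty_subset _, ?_⟩, he⟩
        rw [hFeq] at huF
        exact T.subset_of_mem hP he G.2 ⟨hue, huD⟩ ⟨T.subset huD, huF.2⟩
      · rintro ⟨⟨-, h2⟩, he⟩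
        obtain ⟨u, hu⟩ := T.nonempty_edge_inter he
        refine ⟨he, u, hu.1, ?_⟩
        rw [hFeq]
        exact ⟨hu.2, (h2 hu.1).2⟩
    have h1 := (hiff y₁).1 hy₁
    have h2 := (hiff y₂).1 hy₂
    refine ⟨Icc b G, Or.inr (Or.inr ⟨b, G, rfl, y₁, (height_eq_two_iff hP).2 hy₁.1, ?_,
      hlt G h1.1.2 h2.1.2⟩), ?_⟩
    · refine lt_of_le_not_ge h1.1.1 fun h => ?_
      obtain ⟨u, hu, -⟩ := hy₁.2
      exact absurd (h hu) (notMem_empty u)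
    · ext e
      exact (hiff e).symm

/-- The face lattice of a vertex truncation of `P` is `E₁(L(P))`, ordered by inclusion. -/
theorem nonempty_orderIso (T : IsTruncationBy P D l c) (hP : IsFiniteHull P) :
    Nonempty (FaceLattice D ≃o {S : Set (FaceLattice P) // IsEtElement 1 S}) := by
  let g : {S : Set (FaceLattice P) // IsEtElement 1 S} ↪o Set (FaceLattice P) :=
    OrderEmbedding.ofMapLEIff (fun S => edgesIn S.1) fun S S' =>
      subset_iff_edgesIn_subset hP S.2 S'.2
  refine nonempty_orderIso_of_range_eq (T.edgeEmbedding hP) g (Subset.antisymm ?_ ?_)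
  · rintro _ ⟨F, rfl⟩
    obtain ⟨S, hS, h⟩ := T.exists_isEtElement_of_face hP F
    exact ⟨⟨S, hS⟩, h⟩
  · rintro _ ⟨S, rfl⟩
    exact T.exists_face_of_isEtElement hP S.2

/-- If m is constant on D, the cone at each vertex v makes m minus that constant proportional to `l
v - c v` on P, so it changes sign between v and any other vertex. Three vertices cannot have
pairwise opposite signs, so m is constant on P. -/
theorem vectorSpan_eq [FiniteDimensional ℝ E] (T : IsTruncationBy P D l c) (hP : IsFiniteHull P)
    (hdim : 2 ≤ Module.finrank ℝ (vectorSpan ℝ P)) : vectorSpan ℝ D = vectorSpan ℝ P := by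
  have hne : P.Nonempty := by
    rw [nonempty_iff_ne_empty]
    rintro rfl
    rw [vectorSpan_empty, finrank_bot] at hdim
    omega
  obtain ⟨v₁, hv₁, hv₁P⟩ := hP.exists_exposedPoint (IsExposed.refl P) hne
  obtain ⟨e, he, hve, -, -⟩ := hP.exists_edge_not_subset (IsExposed.refl P)
    (isExposed_singleton hv₁) hv₁ hv₁P (mem_singleton v₁) fun h => by
      have := Submodule.finrank_mono (vectorSpan_mono ℝ h)
      rw [vectorSpan_singleton, finrank_bot] at this
      omega
  obtain ⟨e', he', hve', -, hee'⟩ := hP.exists_edge_not_subset (IsExposed.refl P) he.1 hv₁ hv₁P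
    hve fun h => by
      have := Submodule.finrank_mono (vectorSpan_mono ℝ h)
      rw [he.2] at this
      omega
  obtain ⟨v₂, hv₂, h21, rfl⟩ := he.eq_segment_of_mem hP hv₁ hve
  obtain ⟨v₃, hv₃, h31, rfl⟩ := he'.eq_segment_of_mem hP hv₁ hve'
  have h32 : v₃ ≠ v₂ := by
    rintro rfl
    exact hee' Subset.rfl
  obtain ⟨u₀, hu₀⟩ := T.nonempty_edge_inter he
  refine le_antisymm (vectorSpan_mono ℝ T.subset) ?_
  rw [← Submodule.orthogonal_le_orthogonal_iff]
  intro a ha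
  set m : StrongDual ℝ E := innerSL ℝ a
  have hm : ∀ u ∈ D, m u = m u₀ := by
    intro u hu
    have := (Submodule.mem_orthogonal' _ a).1 ha _ (vsub_mem_vectorSpan ℝ hu hu₀.2)
    rw [vsub_eq_sub, inner_sub_right] at this
    exact sub_eq_zero.1 this
  have key : ∀ v ∈ P.exposedPoints ℝ, ∀ x ∈ P,
      (l v v - c v) * (m x - m u₀) = (m v - m u₀) * (l v x - c v) := by
    intro v hv x hx
    -- This combination of m and `l v` vanishes on all u - v with u an edge point at v, hence on all
    -- of P - v.
    set f : StrongDual ℝ E := (l v v - c v) • m - (m v - m u₀) • l v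
    have hfapp : ∀ z, f z = (l v v - c v) * m z - (m v - m u₀) * l v z := fun z => rfl
    have hf : ∀ z ∈ (fun u => u - v) '' edgePointsAt P D v, f z = 0 := by
      rintro _ ⟨u, ⟨e, he, hve, hu⟩, rfl⟩
      rw [hfapp, map_sub, map_sub, hm u hu.2, T.apply_eq_of_mem hP he hu hv hve]
      ring
    have hmem := T.sub_mem_span hP hv hx
    have h1 := (map_nonpos_of_mem_span f hmem fun z hz => (hf z hz).le).1
    have h2 := (map_nonpos_of_mem_span (-f) hmem fun z hz => by simp [hf z hz]).1
    rw [neg_apply] at h2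
    rw [hfapp, map_sub, map_sub] at h1 h2
    linarith
  have k12 := key v₁ hv₁ v₂ hv₂.1
  have k13 := key v₁ hv₁ v₃ hv₃.1
  have k23 := key v₂ hv₂ v₃ hv₃.1
  have p1 := T.lt_self v₁ hv₁
  have p2 := T.lt_self v₂ hv₂
  have n12 := T.lt_of_ne v₁ hv₁ v₂ hv₂ h21
  have n13 := T.lt_of_ne v₁ hv₁ v₃ hv₃ h31
  have n23 := T.lt_of_ne v₂ hv₂ v₃ hv₃ h32
  have h0 : m v₁ - m u₀ = 0 := by
    rcases lt_trichotomy (m v₁ - m u₀) 0 with h | h | h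
    · have a2 : 0 < m v₂ - m u₀ := by by_contra! h'; nlinarith
      have a3 : 0 < m v₃ - m u₀ := by by_contra! h'; nlinarith
      nlinarith
    · exact h
    · have a2 : m v₂ - m u₀ < 0 := by by_contra! h'; nlinarith
      have a3 : m v₃ - m u₀ < 0 := by by_contra! h'; nlinarith
      nlinarith
  have hconst : ∀ x ∈ P, m x = m u₀ := by
    intro x hx
    have := key v₁ hv₁ x hx
    rw [h0, zero_mul] at this
    rcases mul_eq_zero.1 this with h | h
    · linarith
    · linarith
  have hle : vectorSpan ℝ P ≤ LinearMap.ker m.toLinearMap := by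
    rw [vectorSpan_def, Submodule.span_le]
    rintro _ ⟨x, hx, y, hy, rfl⟩
    change m (x - y) = 0
    rw [map_sub, hconst x hx, hconst y hy, sub_self]
  exact (Submodule.mem_orthogonal' _ a).2 fun z hz => hle hz

theorem isDPolytope [FiniteDimensional ℝ E] (T : IsTruncationBy P D l c) {d : ℕ}
    (hP : IsDPolytope d P) (hd : 2 ≤ d) : IsDPolytope d D := by
  have hspan := T.vectorSpan_eq hP.isFiniteHull (by rw [hP.2]; exact hd)
  have hfin : Module.finrank ℝ (vectorSpan ℝ D) = d := by rw [hspan, hP.2]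
  refine (T.isFiniteHull hP.isFiniteHull).isDPolytope ?_ hfin
  rw [nonempty_iff_ne_empty]
  rintro rfl
  rw [vectorSpan_empty, finrank_bot] at hfin
  omega

end IsTruncationBy

end Truncation

theorem mainTheorem11
    {E : Type*} [NormedAddCommGroup E] [InnerProductSpace ℝ E] [FiniteDimensional ℝ E]
    {F : Type*} [NormedAddCommGroup F] [InnerProductSpace ℝ F] [FiniteDimensional ℝ F]
    (d : ℕ) (hd : 3 ≤ d) (P : Set E) (hP : IsDPolytope d P) :
    (∀ D : Set E, IsVertexTruncation P D →
      IsDPolytope d D ∧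
      ∀ o ∈ intrinsicInterior ℝ D,
        IsDPolytope d (polarAt D o) ∧
        Realizes (polarAt D o) (EtPoset 1 (FaceLattice P))) ∧
    (∀ Q : Set F, IsDPolytope d Q → Nonempty (FaceLattice P ≃o FaceLattice Q) →
      ∀ (D : Set E) (D' : Set F), IsVertexTruncation P D → IsVertexTruncation Q D' →
        Nonempty (FaceLattice D ≃o FaceLattice D')) := by
  refine ⟨fun D hD => ?_, ?_⟩
  · obtain ⟨l, c, T⟩ := hD.exists_isTruncationBy
    have hDd := T.isDPolytope hP (by omega)
    obtain ⟨φ⟩ := T.nonempty_orderIso hP.isFiniteHull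
    exact ⟨hDd, fun o ho => ⟨hDd.polarAt ho,
      -- Polarity reverses the faces of D, and E₁ carries reversed inclusion, so the dual of φ is
      -- what fits.
      ⟨(polarFaceIso hDd.isFiniteHull ho).symm.trans φ.dual⟩⟩⟩
  · rintro Q hQ ⟨f⟩ D D' hD hD'
    obtain ⟨l, c, T⟩ := hD.exists_isTruncationBy
    obtain ⟨l', c', T'⟩ := hD'.exists_isTruncationBy
    obtain ⟨φ⟩ := T.nonempty_orderIso hP.isFiniteHull
    obtain ⟨ψ⟩ := T'.nonempty_orderIso hQ.isFiniteHull
    exact ⟨φ.trans ((EtPoset.congr f 1).trans ψ.symm)⟩
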